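/- Let $N,n\ge 0$ be integers. For $a,b\in\mathbb Z^{N+1}$ put $(a,b)=\sum_i a_ib_i$, and let $\alpha_i=\epsilon_i-\epsilon_{i+1}\in\mathbb Z^{N+1}$, $i=1,\dots,N$, where $\epsilon_1,\dots,\epsilon_{N+1}$ is the standard basis. A partition is a vector $\lambda\in\mathbb Z^{N+1}$ with $\lambda_1\ge\dots\ge\lambda_{N+1}\ge 0$. Let $\lambda^{(1)},\dots,\lambda^{(n)}$ be partitions with $\lambda^{(s)}_{N+1}=0$ for all $s$, let $l_1,\dots,l_N\ge 0$ be integers such that $\lambda^{(\infty)}=\sum_{s}\lambda^{(s)}-\sum_{j} l_j\alpha_j$ is a partition, and let $z_1,\dots,z_n$ be distinct complex numbers. In the variables $t=(t^{(i)}_j)_{1\le i\le N,\,1\le j\le l_i}$ consider the master function $$\Phi(t)=\prod_{i=1}^{N}\prod_{1\le j<j'\le l_i}(t^{(i)}_j-t^{(i)}_{j'})^2\ \prod_{i=1}^{N-1}\prod_{j=1}^{l_i}\prod_{j'=1}^{l_{i+1}}(t^{(i)}_j-t^{(i+1)}_{j'})^{-1}\ \prod_{i=1}^{N}\prod_{j=1}^{l_i}\prod_{s=1}^{n}(t^{(i)}_j-z_s)^{-(\lambda^{(s)},\alpha_i)}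 .$$ Let $l=l_1+\dots+l_N$, let $U\subset\mathbb C^{l}$ be the set of points where $\Phi$ is well-defined and nonzero, $\mathbb C(t)_U$ the algebra of rational functions regular on $U$, $I_\Phi\subset\mathbb C(t)_U$ the ideal generated by all $\Psi_{ij}=\partial(\log\Phi)/\partial t^{(i)}_j$, $A_\Phi=\mathbb C(t)_U/I_\Phi$, and $C_\Phi\subset U$ the zero set of $I_\Phi$ (the set of critical points of $\Phi$ in $U$). For $p\in C_\Phi$ let $A_{p,\Phi}$ be the local algebra of $A_\Phi$ at $p$ (the localization of $A_\Phi$ at the maximal ideal of functions vanishing at $p$), and for $f\in\mathbb C(t)_U$ let $\bar f$ be the image of $f$ in $A_{p,\Phi}$. Put $T_i(u)=\prod_{s=1}^n(u-z_s)^{(\lambda^{(s)},\alpha_i)}$ and $y_i(u,t)=\prod_{j=1}^{l_i}(u-t^{(i)}_j)$ for $1\le i\le N$, and $y_0=y_{N+1}=1$. With $\partial_u=d/du$ and $\log'f=(df/du)/f$, consider the differential operator (product ordered from left to right, $k=0,1,\dots,N$) $$\mathcal D_\Phi=\Bigl(\partial_u-\log'\frac{T_1\cdots T_N}{y_1}\Bigr)\Bigl(\partial_u-\log'\frac{y_1T_2\cdots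 T_N}{y_2}\Bigr)\cdots\bigl(\partial_u-\log' y_N\bigr)=\prod_{k=0}^{N}\Bigl(\partial_u-\log'\frac{y_kT_{k+1}\cdots T_N}{y_{k+1}}\Bigr),$$ and write $\mathcal D_\Phi=\partial_u^{N+1}+\sum_{i=1}^{N+1}G_i\,\partial_u^{N+1-i}$, where $G_i=\sum_{j\ge i}G_{ij}u^{-j}$ is the expansion at $u=\infty$, with $G_{ij}\in\mathbb C[t]$. **Theorem.** For every $p\in C_\Phi$, the elements $\bar G_{ij}$, $i=1,\dots,N+1$, $j\ge i$, generate $A_{p,\Phi}$ as a unital $\mathbb C$-algebra. -/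

import Mathlib

open scoped Polynomial

noncomputable section

namespace GaudinMaster

/-! ### Weights of `gl_{N+1}` -/

/-- Integral weights, written in the basis `ε_1, …, ε_{N+1}` (indexed here by `0, …, N`). -/
abbrev Weight (N : ℕ) : Type := Fin (N + 1) → ℤ

/-- The standard scalar product, for which the `ε_i` are orthonormal. -/
def pairing {N : ℕ} (a b : Weight N) : ℤ := ∑ i, a i * b i

/-- The simple root `α_i = ε_i - ε_{i+1}`. -/
def simpleRoot {N : ℕ} (i : Fin N) : Weight N :=
  Pi.single i.castSucc 1 - Pi.single i.succ 1

/-- A partition with at most `N + 1` parts. -/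
def IsPartition {N : ℕ} (a : Weight N) : Prop :=
  Antitone a ∧ ∀ i, 0 ≤ a i

/-- `λ^(∞) = ∑ λ^(s) - ∑ l_j α_j`. -/
def weightInfty {N n : ℕ} (lam : Fin n → Weight N) (l : Fin N → ℕ) : Weight N :=
  ∑ s, lam s - ∑ j, (l j : ℤ) • simpleRoot j

/-! ### Rational functions in several variables -/

section Rational

variable {σ : Type*}

/-- The polynomial algebra `ℂ[t]`. -/
abbrev Poly (σ : Type*) : Type _ := MvPolynomial σ ℂ

/-- The field `ℂ(t)` of rational functions. -/
abbrev RatField (σ : Type*) : Type _ := FractionRing (MvPolynomial σ ℂ)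

/-- The inclusion of `ℂ[t]` in `ℂ(t)`. -/
def toRat (a : Poly σ) : RatField σ := algebraMap (Poly σ) (RatField σ) a

/-- `f` is regular (well-defined) at `p` and takes there the value `v`. -/
def HasValueAt (f : RatField σ) (p : σ → ℂ) (v : ℂ) : Prop :=
  ∃ a b : Poly σ, MvPolynomial.eval p b ≠ 0 ∧ f = toRat a / toRat b ∧
    v = MvPolynomial.eval p a / MvPolynomial.eval p b

/-- `f` is regular at `p`. -/
def RegularAt (f : RatField σ) (p : σ → ℂ) : Prop := ∃ v, HasValueAt f p v

theorem toRat_ne_zero {p : σ → ℂ} {b : Poly σ} (hb : MvPolynomial.eval p b ≠ 0) :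
    toRat b ≠ 0 := by
  intro h
  have : b = 0 := (IsFractionRing.injective (Poly σ) (RatField σ)) (by simpa [toRat] using h)
  simp [this] at hb

theorem toRat_add (a b : Poly σ) : toRat (a + b) = toRat a + toRat b := map_add _ _ _

theorem toRat_mul (a b : Poly σ) : toRat (a * b) = toRat a * toRat b := map_mul _ _ _

theorem toRat_injective : Function.Injective (toRat (σ := σ)) :=
  IsFractionRing.injective (Poly σ) (RatField σ)

theorem HasValueAt.unique {f : RatField σ} {p : σ → ℂ} {v w : ℂ}
    (hv : HasValueAt f p v) (hw : HasValueAt f p w) : v = w := by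
  obtain ⟨a, b, hb, rfl, rfl⟩ := hv
  obtain ⟨c, d, hd, h, rfl⟩ := hw
  rw [div_eq_div_iff (toRat_ne_zero hb) (toRat_ne_zero hd), ← toRat_mul, ← toRat_mul] at h
  have h2 := congrArg (MvPolynomial.eval p) (toRat_injective h)
  rw [map_mul, map_mul] at h2
  rwa [div_eq_div_iff hb hd]

theorem HasValueAt.add {f g : RatField σ} {p : σ → ℂ} {v w : ℂ}
    (hv : HasValueAt f p v) (hw : HasValueAt g p w) : HasValueAt (f + g) p (v + w) := by
  obtain ⟨a, b, hb, rfl, rfl⟩ := hv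
  obtain ⟨c, d, hd, rfl, rfl⟩ := hw
  refine ⟨a * d + b * c, b * d, by simp [hb, hd], ?_, ?_⟩
  · rw [div_add_div _ _ (toRat_ne_zero hb) (toRat_ne_zero hd)]
    simp only [toRat_add, toRat_mul]
  · rw [div_add_div _ _ hb hd]
    simp only [map_add, map_mul]

theorem HasValueAt.mul {f g : RatField σ} {p : σ → ℂ} {v w : ℂ}
    (hv : HasValueAt f p v) (hw : HasValueAt g p w) : HasValueAt (f * g) p (v * w) := by
  obtain ⟨a, b, hb, rfl, rfl⟩ := hv
  obtain ⟨c, d, hd, rfl, rfl⟩ := hw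
  refine ⟨a * c, b * d, by simp [hb, hd], ?_, ?_⟩
  · rw [div_mul_div_comm]
    simp only [toRat_mul]
  · rw [div_mul_div_comm]
    simp only [map_mul]

theorem hasValueAt_toRat (a : Poly σ) (p : σ → ℂ) :
    HasValueAt (toRat a) p (MvPolynomial.eval p a) :=
  ⟨a, 1, by simp, by simp [toRat], by simp⟩

theorem hasValueAt_algebraMap (c : ℂ) (p : σ → ℂ) :
    HasValueAt (algebraMap ℂ (RatField σ) c) p c := by
  have h := hasValueAt_toRat (MvPolynomial.C c : Poly σ) p
  rwa [MvPolynomial.eval_C, toRat, ← MvPolynomial.algebraMap_eq,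
    ← IsScalarTower.algebraMap_apply] at h

/-- The algebra of rational functions that are regular at all points of a set `U`. -/
def regularAlgebra (U : Set (σ → ℂ)) : Subalgebra ℂ (RatField σ) where
  carrier := {f | ∀ p ∈ U, RegularAt f p}
  mul_mem' hf hg p hp := by
    obtain ⟨v, hv⟩ := hf p hp
    obtain ⟨w, hw⟩ := hg p hp
    exact ⟨_, hv.mul hw⟩
  add_mem' hf hg p hp := by
    obtain ⟨v, hv⟩ := hf p hp
    obtain ⟨w, hw⟩ := hg p hp
    exact ⟨_, hv.add hw⟩
  algebraMap_mem' c p _ := ⟨_, hasValueAt_algebraMap c p⟩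

/-- The value at `p ∈ U` of a function regular on `U`. -/
def valueAt {U : Set (σ → ℂ)} {p : σ → ℂ} (hp : p ∈ U) (f : regularAlgebra U) : ℂ :=
  Classical.choose (f.2 p hp)

theorem hasValueAt_valueAt {U : Set (σ → ℂ)} {p : σ → ℂ} (hp : p ∈ U)
    (f : regularAlgebra U) : HasValueAt (f : RatField σ) p (valueAt hp f) :=
  Classical.choose_spec (f.2 p hp)

/-- Evaluation at a point `p` of `U`, as an algebra homomorphism. -/
def evalHom {U : Set (σ → ℂ)} {p : σ → ℂ} (hp : p ∈ U) : regularAlgebra U →ₐ[ℂ] ℂ where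
  toFun := valueAt hp
  map_one' := by
    have h := hasValueAt_algebraMap (σ := σ) 1 p
    rw [map_one] at h
    exact (hasValueAt_valueAt hp 1).unique h
  map_mul' f g := (hasValueAt_valueAt hp (f * g)).unique
    ((hasValueAt_valueAt hp f).mul (hasValueAt_valueAt hp g))
  map_zero' := by
    have h := hasValueAt_algebraMap (σ := σ) 0 p
    rw [map_zero] at h
    exact (hasValueAt_valueAt hp 0).unique h
  map_add' f g := (hasValueAt_valueAt hp (f + g)).unique
    ((hasValueAt_valueAt hp f).add (hasValueAt_valueAt hp g))
  commutes' c := (hasValueAt_valueAt hp (algebraMap ℂ _ c)).unique (hasValueAt_algebraMap c p)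

/-- The polynomials, as regular functions on `U`. -/
def polyRegular (U : Set (σ → ℂ)) (a : Poly σ) : regularAlgebra U :=
  ⟨toRat a, fun p _ => ⟨_, hasValueAt_toRat a p⟩⟩

/-- The logarithmic partial derivative `(∂f/∂x) / f` of a rational function: for `f = a / b` it is
`(∂a/∂x) / a - (∂b/∂x) / b` (see `logPDeriv_div`), here computed from the reduced fraction. -/
def logPDeriv (x : σ) (f : RatField σ) : RatField σ :=
  toRat (MvPolynomial.pderiv x (IsFractionRing.num (Poly σ) f)) /
      toRat (IsFractionRing.num (Poly σ) f) -
    toRat (MvPolynomial.pderiv x (IsFractionRing.den (Poly σ) f : Poly σ)) /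
      toRat (IsFractionRing.den (Poly σ) f : Poly σ)

theorem logPDeriv_div (x : σ) {a b : Poly σ} (ha : a ≠ 0) (hb : b ≠ 0) :
    logPDeriv x (toRat a / toRat b) =
      toRat (MvPolynomial.pderiv x a) / toRat a - toRat (MvPolynomial.pderiv x b) / toRat b := by
  have nz : ∀ {c : Poly σ}, c ≠ 0 → toRat c ≠ 0 := fun {c} hc h =>
    hc (toRat_injective (by simpa [toRat] using h))
  set f : RatField σ := toRat a / toRat b with hf
  set c := IsFractionRing.num (Poly σ) f with hc
  set d : Poly σ := (IsFractionRing.den (Poly σ) f : Poly σ) with hd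
  have hd0 : d ≠ 0 := nonZeroDivisors.coe_ne_zero _
  have hcd : toRat c / toRat d = f := by
    have := IsFractionRing.mk'_num_den (Poly σ) f
    rwa [IsFractionRing.mk'_eq_div] at this
  have hf0 : f ≠ 0 := div_ne_zero (nz ha) (nz hb)
  have hc0 : c ≠ 0 := by
    intro h
    rw [h] at hcd
    exact hf0 (by rw [← hcd]; simp [toRat])
  have key : c * b = a * d := by
    have h := hcd
    rw [hf, div_eq_div_iff (nz hd0) (nz hb), ← toRat_mul, ← toRat_mul] at h
    exact toRat_injective h
  have key1 := congrArg toRat key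
  have key2 := congrArg (fun q => toRat (MvPolynomial.pderiv x q)) key
  simp only [Derivation.leibniz, smul_eq_mul, toRat_add, toRat_mul] at key1 key2
  have e : logPDeriv x f = toRat (MvPolynomial.pderiv x c) / toRat c -
      toRat (MvPolynomial.pderiv x d) / toRat d := rfl
  rw [e]
  have := nz ha
  have := nz hb
  have := nz hc0
  have := nz hd0
  have h1 : toRat (MvPolynomial.pderiv x c) / toRat c +
      toRat (MvPolynomial.pderiv x b) / toRat b =
      (toRat c * toRat (MvPolynomial.pderiv x b) + toRat b * toRat (MvPolynomial.pderiv x c)) /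
        (toRat c * toRat b) := by
    field_simp
    ring
  have h2 : toRat (MvPolynomial.pderiv x a) / toRat a +
      toRat (MvPolynomial.pderiv x d) / toRat d =
      (toRat a * toRat (MvPolynomial.pderiv x d) + toRat d * toRat (MvPolynomial.pderiv x a)) /
        (toRat a * toRat d) := by
    field_simp
    ring
  rw [key1, key2, ← h2] at h1
  linear_combination h1

/-- Where `f` is well-defined and nonzero, its logarithmic derivatives are regular. -/
theorem regularAt_logPDeriv (x : σ) {f : RatField σ} {p : σ → ℂ} {v : ℂ} (hv : v ≠ 0)
    (h : HasValueAt f p v) : RegularAt (logPDeriv x f) p := by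
  obtain ⟨a, b, hb, rfl, rfl⟩ := h
  have ha : MvPolynomial.eval p a ≠ 0 := fun h => hv (by simp [h])
  have ha0 : a ≠ 0 := by rintro rfl; simp at ha
  have hb0 : b ≠ 0 := by rintro rfl; simp at hb
  rw [logPDeriv_div x ha0 hb0]
  refine ⟨_, MvPolynomial.pderiv x a * b - a * MvPolynomial.pderiv x b, a * b,
    by simp [ha, hb], ?_, rfl⟩
  rw [div_sub_div _ _ (toRat_ne_zero ha) (toRat_ne_zero hb)]
  simp [toRat]

end Rational

/-! ### The master function and the algebra of functions on its critical set -/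

/-- The index set of the variables `t^(i)_j`, `i = 1, …, N`, `j = 1, …, l_i` (indices start
at `0` here). -/
abbrev Var {N : ℕ} (l : Fin N → ℕ) : Type := Σ i : Fin N, Fin (l i)

/-- The variable `t^(i)_j` as a rational function. -/
def tvar {N : ℕ} {l : Fin N → ℕ} (i : Fin N) (j : Fin (l i)) : RatField (Var l) :=
  toRat (MvPolynomial.X ⟨i, j⟩)

/-- The master function `Φ(t)`. -/
def masterFunction {N n : ℕ} (lam : Fin n → Weight N) (l : Fin N → ℕ) (z : Fin n → ℂ) :
    RatField (Var l) :=
  (∏ i : Fin N, ∏ j : Fin (l i), ∏ j' : Fin (l i) with j < j', (tvar i j - tvar i j') ^ 2) *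
  (∏ i : Fin N, ∏ i' : Fin N with i'.val = i.val + 1, ∏ j : Fin (l i), ∏ j' : Fin (l i'),
    (tvar i j - tvar i' j')⁻¹) *
  ∏ i : Fin N, ∏ j : Fin (l i), ∏ s : Fin n,
    (tvar i j - algebraMap ℂ (RatField (Var l)) (z s)) ^ (-pairing (lam s) (simpleRoot i))

/-- The set `U` of the points where `Φ` is well-defined and nonzero. -/
def domainU {N n : ℕ} (lam : Fin n → Weight N) (l : Fin N → ℕ) (z : Fin n → ℂ) :
    Set (Var l → ℂ) :=
  {p | ∃ v, v ≠ 0 ∧ HasValueAt (masterFunction lam l z) p v}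

/-- The algebra `ℂ(t)_U` of rational functions regular on `U`. -/
abbrev RegU {N n : ℕ} (lam : Fin n → Weight N) (l : Fin N → ℕ) (z : Fin n → ℂ) : Type :=
  regularAlgebra (domainU lam l z)

/-- `Ψ_ij = ∂ log Φ / ∂ t^(i)_j`, an element of `ℂ(t)_U`. -/
def Psi {N n : ℕ} (lam : Fin n → Weight N) (l : Fin N → ℕ) (z : Fin n → ℂ) (x : Var l) :
    RegU lam l z :=
  ⟨logPDeriv x (masterFunction lam l z), fun _ ⟨_, hv, h⟩ => regularAt_logPDeriv x hv h⟩

/-- The ideal `I_Φ` generated by the `Ψ_ij`. -/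
def idealPhi {N n : ℕ} (lam : Fin n → Weight N) (l : Fin N → ℕ) (z : Fin n → ℂ) :
    Ideal (RegU lam l z) :=
  Ideal.span (Set.range (Psi lam l z))

/-- The algebra `A_Φ = ℂ(t)_U / I_Φ`. -/
abbrev APhi {N n : ℕ} (lam : Fin n → Weight N) (l : Fin N → ℕ) (z : Fin n → ℂ) : Type :=
  RegU lam l z ⧸ idealPhi lam l z

/-- The critical set `C_Φ`: the zero set in `U` of the ideal `I_Φ`. -/
def criticalSet {N n : ℕ} (lam : Fin n → Weight N) (l : Fin N → ℕ) (z : Fin n → ℂ) :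
    Set (Var l → ℂ) :=
  {p | ∃ hp : p ∈ domainU lam l z, ∀ f ∈ idealPhi lam l z, evalHom hp f = 0}

/-- Evaluation at a critical point `p`, as a homomorphism from `A_Φ` to `ℂ`. -/
def evalAPhi {N n : ℕ} {lam : Fin n → Weight N} {l : Fin N → ℕ} {z : Fin n → ℂ}
    {p : Var l → ℂ} (hp : p ∈ criticalSet lam l z) : APhi lam l z →ₐ[ℂ] ℂ :=
  Ideal.Quotient.liftₐ (idealPhi lam l z) (evalHom hp.fst) hp.snd

/-- The maximal ideal of `A_Φ` that consists of the functions vanishing at `p`. -/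
def maxIdealAt {N n : ℕ} {lam : Fin n → Weight N} {l : Fin N → ℕ} {z : Fin n → ℂ}
    {p : Var l → ℂ} (hp : p ∈ criticalSet lam l z) : Ideal (APhi lam l z) :=
  RingHom.ker (evalAPhi hp)

instance maxIdealAt_isPrime {N n : ℕ} {lam : Fin n → Weight N} {l : Fin N → ℕ} {z : Fin n → ℂ}
    {p : Var l → ℂ} (hp : p ∈ criticalSet lam l z) : (maxIdealAt hp).IsPrime :=
  RingHom.ker_isPrime (evalAPhi hp)

/-- The local algebra `A_{p,Φ}` of `A_Φ` at the critical point `p`. -/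
abbrev LocalAlgebra {N n : ℕ} {lam : Fin n → Weight N} {l : Fin N → ℕ} {z : Fin n → ℂ}
    {p : Var l → ℂ} (hp : p ∈ criticalSet lam l z) : Type :=
  Localization.AtPrime (R := APhi lam l z) (maxIdealAt hp)

/-- The homomorphism `f ↦ f̄` from `ℂ(t)_U` to `A_{p,Φ}`. -/
def toLocal {N n : ℕ} {lam : Fin n → Weight N} {l : Fin N → ℕ} {z : Fin n → ℂ}
    {p : Var l → ℂ} (hp : p ∈ criticalSet lam l z) : RegU lam l z →ₐ[ℂ] LocalAlgebra hp :=
  (IsScalarTower.toAlgHom ℂ (APhi lam l z) (LocalAlgebra hp)).comp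
    (Ideal.Quotient.mkₐ ℂ (idealPhi lam l z))

/-! ### Differential operators in `u`, expanded at `u = ∞` -/

section DiffOp

variable {R : Type*} [CommRing R]

/-- Laurent series in `u⁻¹`: the coefficient with index `j` is that of `u^(-j)`. -/
abbrev SeriesAtInfty (R : Type*) [CommRing R] : Type _ := LaurentSeries R

/-- The expansion at `u = ∞` of a polynomial in `u`. -/
def expandAtInfty : R[X] →+* SeriesAtInfty R :=
  Polynomial.eval₂RingHom HahnSeries.C (HahnSeries.single (-1) 1)

/-- `d/du = -w² d/dw` for `w = u⁻¹`. -/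
def du (f : SeriesAtInfty R) : SeriesAtInfty R :=
  -(HahnSeries.single 2 1 * LaurentSeries.derivative R f)

/-- The derivation `d/du` sends `c u^(-j)` to `-j c u^(-j-1)`. -/
theorem du_coeff (f : SeriesAtInfty R) (j : ℤ) :
    (du f).coeff (j + 1) = -(j • f.coeff j) := by
  have h := HahnSeries.coeff_single_mul_add (r := (1 : R))
    (x := LaurentSeries.derivative R f) (a := j - 1) (b := (2 : ℤ))
  have e : j - 1 + 2 = j + 1 := by ring
  rw [e] at h
  rw [du, HahnSeries.coeff_neg, h]
  simp [LaurentSeries.derivative_apply, LaurentSeries.hasseDeriv_coeff]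

/-- The logarithmic derivative `log' f = (df/du) / f` of an invertible series `f`. -/
def logDu (f : SeriesAtInfty R) : SeriesAtInfty R := du f * Ring.inverse f

/-- The expansion of `u - c` is invertible; so all the series that are inverted below are units. -/
theorem isUnit_expandAtInfty_X_sub_C (c : R) :
    IsUnit (expandAtInfty (Polynomial.X - Polynomial.C c)) := by
  have e : expandAtInfty (Polynomial.X - Polynomial.C c) =
      HahnSeries.single (-1 : ℤ) (1 : R) * (1 - HahnSeries.single 1 c) := by
    rw [mul_sub, HahnSeries.single_mul_single]
    simp [expandAtInfty, HahnSeries.C_apply]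
  rw [e]
  refine IsUnit.mul ?_ (HahnSeries.isUnit_of_orderTop_pos ?_)
  · exact IsUnit.of_mul_eq_one (HahnSeries.single 1 1) (by
      rw [HahnSeries.single_mul_single]; simp)
  · have e2 : (1 - HahnSeries.single 1 c - 1 : SeriesAtInfty R) = HahnSeries.single 1 (-c) := by
      simp
    rw [e2]
    exact lt_of_lt_of_le (by norm_num) HahnSeries.orderTop_single_le

/-- A differential operator `∑ a_k (d/du)^k` is recorded as the polynomial `∑ a_k X^k`. -/
abbrev DiffOp (R : Type*) [CommRing R] : Type _ := (SeriesAtInfty R)[X]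

/-- The operator product `(d/du - g) · P`: by the Leibniz rule,
`(d/du - g) ∑ a_k (d/du)^k = ∑ (a_k (d/du)^(k+1) + a_k' (d/du)^k - g a_k (d/du)^k)`. -/
def firstOrderMul (g : SeriesAtInfty R) (P : DiffOp R) : DiffOp R :=
  Polynomial.X * P + P.sum (fun k a => Polynomial.monomial k (du a)) - Polynomial.C g * P

end DiffOp

/-- `T_i(u) = ∏_s (u - z_s)^((λ^(s), α_i))`. The exponents are nonnegative when the `λ^(s)` are
partitions. -/
def Tpoly {N n : ℕ} (lam : Fin n → Weight N) (l : Fin N → ℕ) (z : Fin n → ℂ) (i : Fin N) :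
    (Poly (Var l))[X] :=
  ∏ s : Fin n, (Polynomial.X - Polynomial.C (MvPolynomial.C (z s))) ^
    (pairing (lam s) (simpleRoot i)).toNat

/-- `y_k(u, t) = ∏_j (u - t^(k)_j)` for `k = 1, …, N`; the product is empty, and `y_k = 1`, for
`k = 0` and for `k = N + 1`. -/
def ypoly {N : ℕ} (l : Fin N → ℕ) (k : ℕ) : (Poly (Var l))[X] :=
  ∏ x : Var l with x.1.val + 1 = k, (Polynomial.X - Polynomial.C (MvPolynomial.X x))

/-- The function `y_k T_{k+1} ⋯ T_N / y_{k+1}`, `k = 0, …, N` (with `y_0 = y_{N+1} = 1`). -/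
def factorFun {N n : ℕ} (lam : Fin n → Weight N) (l : Fin N → ℕ) (z : Fin n → ℂ) (k : ℕ) :
    SeriesAtInfty (Poly (Var l)) :=
  expandAtInfty (ypoly l k * ∏ i : Fin N with k ≤ i.val, Tpoly lam l z i) *
    Ring.inverse (expandAtInfty (ypoly l (k + 1)))

/-- The operator `D_Φ`, the ordered product over `k = 0, …, N` (from left to right) of the factors
`d/du - log'(y_k T_{k+1} ⋯ T_N / y_{k+1})`. -/
def operatorDPhi {N n : ℕ} (lam : Fin n → Weight N) (l : Fin N → ℕ) (z : Fin n → ℂ) :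
    DiffOp (Poly (Var l)) :=
  (List.range (N + 1)).foldr (fun k P => firstOrderMul (logDu (factorFun lam l z k)) P) 1

/-- The coefficient `G_ij ∈ ℂ[t]` of `u^(-j) (d/du)^(N+1-i)` in `D_Φ`. -/
def coeffG {N n : ℕ} (lam : Fin n → Weight N) (l : Fin N → ℕ) (z : Fin n → ℂ) (i j : ℕ) :
    Poly (Var l) :=
  ((operatorDPhi lam l z).coeff (N + 1 - i)).coeff (j : ℤ)

/-- The image of `G_ij` in the local algebra `A_{p,Φ}`. -/
def coeffGBar {N n : ℕ} {lam : Fin n → Weight N} {l : Fin N → ℕ} {z : Fin n → ℂ}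
    {p : Var l → ℂ} (hp : p ∈ criticalSet lam l z) (i j : ℕ) : LocalAlgebra hp :=
  toLocal hp (polyRegular (domainU lam l z) (coeffG lam l z i j))

end GaudinMaster

end

/-!
The proof has two independent halves.

*The coefficients of the polynomials `y_k` are polynomials in the `G_ij`*, already in `ℂ[t]`. Write
`D_Φ = (∂ - h_0) ⋯ (∂ - h_N)`. The leading term of `h_k` at infinity is `λ^(∞)_{k+1} u⁻¹`, and these
exponents weakly decrease, as `λ^(∞)` is a partition. The remainder of `D_Φ` on division by `∂ - g` from
the left is polynomial in the `G_ij` and the coefficients of `g`. When `g` is a truncation of `h_0`,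
the leading coefficient of this remainder is the first neglected coefficient of `h_0` times a
nonzero integer (`leftRem_operatorOf`, `foldl_leading`). So all coefficients of `h_0` are polynomials
in the `G_ij`; dividing `∂ - h_0` out and repeating gives those of every `h_k`
(`mem_of_operatorOf_mem`). Up to constants the coefficients of `h_k` are differences of power sums of
the variables of colors `k` and `k + 1`, and Newton's identities finish
(`coeff_prod_level_mem`).

*The critical point `p` is isolated*, that is, the maximal ideal of the local algebra is
nilpotent. It is enough that a critical point with coordinates in an extension field `K` of `ℂ` has
coordinates algebraic over `ℂ` (`isIntegral_of_critical`). Take a valuation of `K` trivial on `ℂ`,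
suppose that `r_i ≥ 0` of the coordinates of color `i` have a pole, and sum `t ∂ log Φ / ∂ t` over the
coordinates with poles. This sum is zero, and modulo the maximal ideal of the valuation ring it is
the integer `-(λ^(∞), β) - (β, β) / 2 - ∑ r_i`, where `β = ∑ r_i α_i`. As `λ^(∞)` is dominant this is
negative unless all `r_i` vanish (`eq_zero_of_escape_exponent_eq_zero`).

Consequently the subalgebra `B` generated by the `G_ij` in the local algebra satisfies Hensel's
lemma: each coordinate `t_x` is a root of some `y_k`, a polynomial over `B` whose roots at `p` are
simple, hence `t_x ∈ B` (`map_X_mem`). Elements of `B` not vanishing at `p` are invertible in `B`, so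
`B` contains all fractions of polynomials and is the whole local algebra (`eq_top_of_coeff_mem`).
-/

noncomputable section

namespace GaudinMaster

/-! ### Laurent series at infinity and logarithmic derivatives -/

section Series

variable {R : Type*} [CommRing R]

/-- A product of two series starts no earlier than the sum of the starting exponents, where its
coefficient is the product of the two starting coefficients. -/
theorem coeff_mul_of_vanish {f g : SeriesAtInfty R} {a b : ℤ}
    (hf : ∀ j < a, f.coeff j = 0) (hg : ∀ j < b, g.coeff j = 0) :
    (∀ j < a + b, (f * g).coeff j = 0) ∧ (f * g).coeff (a + b) = f.coeff a * g.coeff b := by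
  constructor
  · intro j hj
    rw [HahnSeries.coeff_mul]
    refine Finset.sum_eq_zero fun x hx => ?_
    have hx := (Finset.mem_antidiagonal.1 hx).2.2
    by_cases h : x.1 < a
    · rw [hf _ h, zero_mul]
    · rw [hg _ (by omega), mul_zero]
  · rw [HahnSeries.coeff_mul, Finset.sum_eq_single (a, b)]
    · rintro ⟨i, k⟩ hx hne
      have hx := (Finset.mem_antidiagonal.1 hx).2.2
      by_cases h : i < a
      · rw [hf _ h, zero_mul]
      · by_cases h' : k < b
        · rw [hg _ h', mul_zero]
        · exact absurd (Prod.ext (by simp at hx ⊢; omega) (by simp at hx ⊢; omega)) hne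
    · intro h
      by_cases h1 : f.coeff a = 0
      · simp [h1]
      · by_cases h2 : g.coeff b = 0
        · simp [h2]
        · exact absurd (Finset.mem_antidiagonal.2 ⟨h1, h2, rfl⟩) h

theorem du_coeff' (f : SeriesAtInfty R) (j : ℤ) :
    (du f).coeff j = -((j - 1) • f.coeff (j - 1)) := by
  have := du_coeff f (j - 1)
  rwa [sub_add_cancel] at this

theorem du_add (f g : SeriesAtInfty R) : du (f + g) = du f + du g := by
  ext j; simp only [du_coeff', HahnSeries.coeff_add, smul_add, neg_add]

theorem du_zero : du (0 : SeriesAtInfty R) = 0 := by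
  ext j; simp [du_coeff']

theorem du_one : du (1 : SeriesAtInfty R) = 0 := by
  ext j
  rw [du_coeff', HahnSeries.coeff_one]
  split_ifs with h <;> simp [h]

/-- The Euler operator `w d/dw`, which multiplies the coefficient of `w^j` by `j`. -/
def euler (f : SeriesAtInfty R) : SeriesAtInfty R :=
  HahnSeries.single 1 1 * LaurentSeries.derivative R f

theorem euler_coeff (f : SeriesAtInfty R) (j : ℤ) : (euler f).coeff j = j • f.coeff j := by
  have h := HahnSeries.coeff_single_mul_add (r := (1 : R))
    (x := LaurentSeries.derivative R f) (a := j - 1) (b := (1 : ℤ))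
  rw [sub_add_cancel] at h
  rw [euler, h]
  simp [LaurentSeries.derivative_apply, LaurentSeries.hasseDeriv_coeff]

theorem euler_mul (f g : SeriesAtInfty R) : euler (f * g) = euler f * g + f * euler g := by
  have hs : ∀ f : SeriesAtInfty R, (euler f).support ⊆ f.support := by
    intro f j hj h
    exact hj (by rw [euler_coeff, h, smul_zero])
  ext j
  rw [HahnSeries.coeff_add, euler_coeff, HahnSeries.coeff_mul,
    HahnSeries.coeff_mul_left' f.isPWO_support (hs f),
    HahnSeries.coeff_mul_right' g.isPWO_support (hs g), Finset.smul_sum, ← Finset.sum_add_distrib]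
  refine Finset.sum_congr rfl fun x hx => ?_
  have hx := (Finset.mem_antidiagonal.1 hx).2.2
  rw [euler_coeff, euler_coeff, ← hx, add_smul, smul_mul_assoc, mul_smul_comm]

theorem du_eq_euler (f : SeriesAtInfty R) : du f = -(HahnSeries.single 1 1 * euler f) := by
  rw [du, euler, ← mul_assoc, HahnSeries.single_mul_single]
  norm_num

theorem du_mul (f g : SeriesAtInfty R) : du (f * g) = du f * g + f * du g := by
  simp only [du_eq_euler, euler_mul]
  ring

theorem logDu_mul {f g : SeriesAtInfty R} (hf : IsUnit f) (hg : IsUnit g) :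
    logDu (f * g) = logDu f + logDu g := by
  have h1 := Ring.mul_inverse_cancel f hf
  have h2 := Ring.mul_inverse_cancel g hg
  rw [logDu, logDu, logDu, du_mul, Ring.mul_inverse_rev]
  linear_combination (du f * Ring.inverse f) * h2 + (du g * Ring.inverse g) * h1

theorem logDu_one : logDu (1 : SeriesAtInfty R) = 0 := by
  rw [logDu, du_one, zero_mul]

theorem logDu_inverse {f : SeriesAtInfty R} (hf : IsUnit f) :
    logDu (Ring.inverse f) = -logDu f := by
  have h := logDu_mul hf hf.ringInverse
  rw [Ring.mul_inverse_cancel f hf, logDu_one] at h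
  exact (neg_eq_of_add_eq_zero_right h.symm).symm

theorem logDu_prod {ι : Type*} (s : Finset ι) (f : ι → SeriesAtInfty R)
    (hf : ∀ i ∈ s, IsUnit (f i)) :
    IsUnit (∏ i ∈ s, f i) ∧ logDu (∏ i ∈ s, f i) = ∑ i ∈ s, logDu (f i) := by
  classical
  induction s using Finset.induction_on with
  | empty => simp [logDu_one]
  | insert a s ha ih =>
    obtain ⟨h1, h2⟩ := ih fun i hi => hf i (Finset.mem_insert_of_mem hi)
    have h3 := hf a (Finset.mem_insert_self a s)
    rw [Finset.prod_insert ha, Finset.sum_insert ha]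
    exact ⟨h3.mul h1, by rw [logDu_mul h3 h1, h2]⟩

theorem logDu_pow {f : SeriesAtInfty R} (hf : IsUnit f) (n : ℕ) :
    logDu (f ^ n) = n • logDu f := by
  have := (logDu_prod (Finset.range n) (fun _ => f) (fun _ _ => hf)).2
  simpa using this

/-- `log' (u - c) = ∑_{j ≥ 0} c^j u^(-j-1)`. -/
theorem logDu_X_sub_C_coeff (c : R) (j : ℤ) :
    (logDu (expandAtInfty (Polynomial.X - Polynomial.C c))).coeff j =
      if 1 ≤ j then c ^ (j - 1).toNat else 0 := by
  set f := expandAtInfty (Polynomial.X - Polynomial.C c) with hf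
  have hf' : f = HahnSeries.single (-1) 1 - HahnSeries.C c := by
    simp [hf, expandAtInfty]
  have hdu : du f = 1 := by
    ext j
    rw [du_coeff', hf', HahnSeries.coeff_sub, HahnSeries.coeff_single, HahnSeries.C_apply,
      HahnSeries.coeff_single, HahnSeries.coeff_one]
    by_cases h0 : j = 0
    · subst h0; simp
    · by_cases h1 : j = 1
      · subst h1; simp
      · have h2 : j - 1 ≠ -1 := by omega
        have h3 : j - 1 ≠ 0 := by omega
        simp [h0, h2, h3]
  have hu : IsUnit f := isUnit_expandAtInfty_X_sub_C c
  let q : SeriesAtInfty R := HahnSeries.single 1 1 * HahnSeries.ofPowerSeries ℤ R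
    (PowerSeries.mk fun n => c ^ n)
  have hq : q * f = 1 := by
    have h1 : (PowerSeries.mk fun n => c ^ n) * (1 - PowerSeries.C c * PowerSeries.X) = 1 := by
      ext n
      rw [mul_sub, mul_one, map_sub, mul_comm (PowerSeries.C c), ← mul_assoc]
      cases n with
      | zero => simp
      | succ n => simp [PowerSeries.coeff_succ_mul_X, PowerSeries.coeff_one, pow_succ]
    have h2 := congrArg (HahnSeries.ofPowerSeries ℤ R) h1
    rw [map_mul, map_one, map_sub, map_one, map_mul, HahnSeries.ofPowerSeries_C,
      HahnSeries.ofPowerSeries_X] at h2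
    have h3 : f = HahnSeries.single (-1) 1 * (1 - HahnSeries.C c * HahnSeries.single 1 1) := by
      rw [hf', mul_sub, mul_one, mul_left_comm, HahnSeries.single_mul_single]
      simp
    have h4 : (HahnSeries.single (1 : ℤ) (1 : R)) * HahnSeries.single (-1) 1 = 1 := by
      rw [HahnSeries.single_mul_single]; simp
    rw [h3]
    linear_combination h2 + (HahnSeries.ofPowerSeries ℤ R (PowerSeries.mk fun n => c ^ n)) *
      (1 - HahnSeries.C c * HahnSeries.single 1 1) * h4
  have hinv : Ring.inverse f = q := by
    have := Ring.mul_inverse_cancel f hu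
    linear_combination q * this - Ring.inverse f * hq
  rw [logDu, hdu, one_mul, hinv]
  have h := HahnSeries.coeff_single_mul_add (r := (1 : R))
    (x := HahnSeries.ofPowerSeries ℤ R (PowerSeries.mk fun n => c ^ n)) (a := j - 1) (b := (1 : ℤ))
  rw [sub_add_cancel, one_mul] at h
  rw [h, PowerSeries.coeff_coe]
  by_cases hj : 1 ≤ j
  · rw [if_neg (by omega), if_pos hj, PowerSeries.coeff_mk]
    congr 1
    omega
  · rw [if_pos (by omega), if_neg hj]

end Series

section Extraction

variable {R : Type*} [CommRing R] [Algebra ℂ R]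

/-- The Laurent series with all coefficients in a subalgebra `B`. -/
def seriesIn (B : Subalgebra ℂ R) : Subring (SeriesAtInfty R) where
  carrier := {f | ∀ j, f.coeff j ∈ B}
  mul_mem' hf hg j := by
    rw [HahnSeries.coeff_mul]
    exact sum_mem fun x _ => mul_mem (hf _) (hg _)
  one_mem' j := by
    rw [HahnSeries.coeff_one]
    split_ifs
    exacts [one_mem _, zero_mem _]
  add_mem' hf hg j := by
    rw [HahnSeries.coeff_add]
    exact add_mem (hf _) (hg _)
  zero_mem' j := by simp
  neg_mem' hf j := by
    rw [HahnSeries.coeff_neg]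
    exact neg_mem (hf _)

theorem mem_seriesIn {B : Subalgebra ℂ R} {f : SeriesAtInfty R} :
    f ∈ seriesIn B ↔ ∀ j, f.coeff j ∈ B := Iff.rfl

theorem du_mem_seriesIn {B : Subalgebra ℂ R} {f : SeriesAtInfty R} (hf : f ∈ seriesIn B) :
    du f ∈ seriesIn B := fun j => by
  rw [du_coeff']
  exact neg_mem (zsmul_mem (hf _) _)

end Extraction

/-! ### Recovering the factors of a differential operator -/

section Operators

variable {R : Type*} [CommRing R]

theorem firstOrderMul_coeff (h : SeriesAtInfty R) (P : DiffOp R) (k : ℕ) :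
    (firstOrderMul h P).coeff k =
      (if k = 0 then 0 else P.coeff (k - 1)) + du (P.coeff k) - h * P.coeff k := by
  rw [firstOrderMul, Polynomial.coeff_sub, Polynomial.coeff_add, Polynomial.coeff_C_mul]
  congr 2
  · cases k <;> simp [Polynomial.coeff_X_mul]
  · rw [Polynomial.sum_def, Polynomial.finsetSum_coeff]
    simp only [Polynomial.coeff_monomial]
    rw [Finset.sum_ite_eq' P.support k]
    split_ifs with hk
    · rfl
    · rw [Polynomial.notMem_support_iff.1 hk, du_zero]

/-- The ordered product `(d/du - h_1) ⋯ (d/du - h_m)`. -/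
def operatorOf (hs : List (SeriesAtInfty R)) : DiffOp R :=
  hs.foldr firstOrderMul 1

theorem operatorOf_cons (h : SeriesAtInfty R) (hs : List (SeriesAtInfty R)) :
    operatorOf (h :: hs) = firstOrderMul h (operatorOf hs) := rfl

theorem operatorOf_coeff_of_length_le (hs : List (SeriesAtInfty R)) (k : ℕ)
    (hk : hs.length ≤ k) :
    (operatorOf hs).coeff k = if k = hs.length then 1 else 0 := by
  induction hs generalizing k with
  | nil => simp [operatorOf, Polynomial.coeff_one]
  | cons h hs ih =>
    rw [List.length_cons] at hk ⊢
    rw [operatorOf_cons, firstOrderMul_coeff, if_neg (by omega), ih (k - 1) (by omega),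
      ih k (by omega), if_neg (show k ≠ hs.length by omega), du_zero, mul_zero, add_zero, sub_zero]
    exact if_congr (by omega) rfl rfl

/-- The coefficient of `(d/du)^k` in a product of `m` factors `d/du - h`, with `h = O(u⁻¹)`,
is `O(u^(k-m))`. -/
theorem operatorOf_coeff_coeff_eq_zero (hs : List (SeriesAtInfty R))
    (h0 : ∀ h ∈ hs, ∀ j < 1, h.coeff j = 0) (k : ℕ) (j : ℤ) (hj : j + k < hs.length) :
    ((operatorOf hs).coeff k).coeff j = 0 := by
  induction hs generalizing k j with
  | nil =>
    have hj : j + k < 0 := by simpa using hj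
    rw [operatorOf_coeff_of_length_le _ _ (by simp)]
    split_ifs
    · rw [HahnSeries.coeff_one, if_neg (by omega)]
    · rfl
  | cons h hs ih =>
    rw [List.length_cons] at hj
    push_cast at hj
    have ih := ih fun g hg => h0 g (List.mem_cons_of_mem _ hg)
    rw [operatorOf_cons, firstOrderMul_coeff, HahnSeries.coeff_sub, HahnSeries.coeff_add, du_coeff',
      ih k (j - 1) (by omega), smul_zero, neg_zero, add_zero,
      (coeff_mul_of_vanish (a := 1) (b := hs.length - k) (h0 h (by simp))
        (fun i hi => ih k i (by omega))).1 j (by omega), sub_zero]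
    split_ifs
    · rfl
    · exact ih _ _ (by omega)

/-- The operator `g - d/du` on series. -/
def twist (g s : SeriesAtInfty R) : SeriesAtInfty R := g * s - du s

theorem twist_add (g s t : SeriesAtInfty R) : twist g (s + t) = twist g s + twist g t := by
  rw [twist, twist, twist, du_add]; ring

theorem twist_iterate_add (g s t : SeriesAtInfty R) (k : ℕ) :
    (twist g)^[k] (s + t) = (twist g)^[k] s + (twist g)^[k] t := by
  induction k generalizing s t with
  | zero => rfl
  | succ k ih => simp only [Function.iterate_succ_apply, twist_add, ih]

theorem twist_iterate_zero (g : SeriesAtInfty R) (k : ℕ) : (twist g)^[k] 0 = 0 :=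
  Function.iterate_fixed (by rw [twist, mul_zero, du_zero, sub_zero]) k

/-- The remainder of the operator `∑_{k < n} a_k (d/du)^k` on division by `d/du - g` from the
left. As `a d/du = (d/du - g) a + (g a - a')`, it is `∑_k (g - d/du)^k a_k`. -/
def leftRem (g : SeriesAtInfty R) (n : ℕ) (a : ℕ → SeriesAtInfty R) : SeriesAtInfty R :=
  ∑ k ∈ Finset.range n, (twist g)^[k] (a k)

theorem leftRem_add (g : SeriesAtInfty R) (n : ℕ) (a b : ℕ → SeriesAtInfty R) :
    leftRem g n (fun k => a k + b k) = leftRem g n a + leftRem g n b := by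
  simp only [leftRem, twist_iterate_add, Finset.sum_add_distrib]

theorem leftRem_succ (g : SeriesAtInfty R) (n : ℕ) (a : ℕ → SeriesAtInfty R) (ha : a n = 0) :
    leftRem g (n + 1) a = leftRem g n a := by
  rw [leftRem, Finset.sum_range_succ, ha, twist_iterate_zero, add_zero, leftRem]

theorem leftRem_shift (g : SeriesAtInfty R) (n : ℕ) (a : ℕ → SeriesAtInfty R) :
    leftRem g (n + 1) (fun k => if k = 0 then 0 else a (k - 1)) =
      leftRem g n (fun k => twist g (a k)) := by
  rw [leftRem, Finset.sum_range_succ', leftRem]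
  simp [Function.iterate_succ_apply]

/-- The left remainder modulo `d/du - g` of `s · (d/du - h_1) ⋯ (d/du - h_m)`, computed factor by
factor: `s (d/du - h) ≡ (g - h) s - s'`. -/
theorem leftRem_operatorOf (g s : SeriesAtInfty R) (hs : List (SeriesAtInfty R)) :
    leftRem g (hs.length + 1) (fun k => s * (operatorOf hs).coeff k) =
      hs.foldl (fun s h => (g - h) * s - du s) s := by
  induction hs generalizing s with
  | nil => simp [leftRem, operatorOf]
  | cons h hs ih =>
    rw [List.length_cons, List.foldl_cons, ← ih]
    set Q := operatorOf hs with hQ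
    have hQn : Q.coeff (hs.length + 1) = 0 := by
      rw [hQ, operatorOf_coeff_of_length_le _ _ (by omega), if_neg (by omega)]
    have e : ∀ k, s * (operatorOf (h :: hs)).coeff k =
        (if k = 0 then 0 else s * Q.coeff (k - 1)) + (s * du (Q.coeff k) - h * (s * Q.coeff k)) := by
      intro k
      rw [operatorOf_cons, firstOrderMul_coeff]
      split_ifs <;> ring
    simp only [e]
    rw [leftRem_add, leftRem_shift g (hs.length + 1) (fun k => s * Q.coeff k),
      leftRem_succ g (hs.length + 1)
        (fun k => s * du (Q.coeff k) - h * (s * Q.coeff k)) (by simp [hQn, du_zero]), ← leftRem_add]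
    congr 1
    funext k
    rw [twist, du_mul]
    ring

/-- The remainder `s ↦ ∏ ((g - h) - d/du) s`, applied to a series that starts at `u^(-a)`: each
factor multiplies the leading coefficient by the integer `e_0 - e(h) + a > 0`, with the current
value of `a`. -/
theorem foldl_leading (g : SeriesAtInfty R) (hs : List (SeriesAtInfty R))
    (e : SeriesAtInfty R → ℤ) (e0 : ℤ)
    (hs0 : ∀ h ∈ hs, ∀ j < 1, (g - h).coeff j = 0)
    (hs1 : ∀ h ∈ hs, (g - h).coeff 1 = ((e0 - e h : ℤ) : R))
    (hle : ∀ h ∈ hs, e h ≤ e0) (s : SeriesAtInfty R) (a : ℤ) (ha : 0 < a)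
    (hsa : ∀ j < a, s.coeff j = 0) :
    ∃ m : ℤ, 0 < m ∧ (hs.foldl (fun s h => (g - h) * s - du s) s).coeff (a + hs.length) =
      m * s.coeff a := by
  induction hs generalizing s a with
  | nil => exact ⟨1, one_pos, by simp⟩
  | cons h hs ih =>
    obtain ⟨h1, h2⟩ := coeff_mul_of_vanish (hs0 h (by simp)) hsa
    obtain ⟨m, hm, hm'⟩ := ih (fun k hk => hs0 k (List.mem_cons_of_mem _ hk))
      (fun k hk => hs1 k (List.mem_cons_of_mem _ hk))
      (fun k hk => hle k (List.mem_cons_of_mem _ hk)) ((g - h) * s - du s) (a + 1) (by omega)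
      (fun j hj => by
        rw [HahnSeries.coeff_sub, h1 _ (by omega), du_coeff', hsa _ (by omega), smul_zero, neg_zero,
          sub_zero])
    have hh := hle h (by simp)
    refine ⟨m * (e0 - e h + a), mul_pos hm (by omega), ?_⟩
    rw [List.foldl_cons, List.length_cons]
    have e1 : a + ((hs.length + 1 : ℕ) : ℤ) = a + 1 + hs.length := by push_cast; ring
    rw [e1, hm', HahnSeries.coeff_sub, add_comm a 1, h2, hs1 h (by simp), add_comm 1 a, du_coeff]
    push_cast
    rw [zsmul_eq_mul]
    ring

variable [Algebra ℂ R]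

theorem leftRem_mem {B : Subalgebra ℂ R} {g : SeriesAtInfty R} (hg : g ∈ seriesIn B) (n : ℕ)
    {a : ℕ → SeriesAtInfty R} (ha : ∀ k, a k ∈ seriesIn B) : leftRem g n a ∈ seriesIn B := by
  refine sum_mem fun k _ => ?_
  suffices ∀ (k : ℕ) (s : SeriesAtInfty R), s ∈ seriesIn B → (twist g)^[k] s ∈ seriesIn B from
    this k _ (ha k)
  intro k
  induction k with
  | zero => exact fun s hs => hs
  | succ k ih => exact fun s hs => ih _ (sub_mem (mul_mem hg hs) (du_mem_seriesIn hs))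

theorem mem_of_intCast_mul_mem {B : Subalgebra ℂ R} {m : ℤ} (hm : m ≠ 0) {x : R}
    (h : (m : R) * x ∈ B) : x ∈ B := by
  have h1 := B.smul_mem h ((m : ℂ)⁻¹)
  have h2 : (m : R) * x = (m : ℂ) • x := by
    rw [Algebra.smul_def, map_intCast]
  rwa [h2, smul_smul, inv_mul_cancel₀ (Int.cast_ne_zero.2 hm), one_smul] at h1

/-- The factors of an operator can be recovered from its coefficients: if
`(d/du - h_1) ⋯ (d/du - h_m)`, with `h_k = e_k u⁻¹ + O(u⁻²)` and `e_1 ≥ ⋯ ≥ e_m`, has all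
coefficients in `B`, then so do all the `h_k`. -/
theorem mem_of_operatorOf_mem {B : Subalgebra ℂ R} (e : SeriesAtInfty R → ℤ)
    (hs : List (SeriesAtInfty R)) (h0 : ∀ h ∈ hs, ∀ j < 1, h.coeff j = 0)
    (h1 : ∀ h ∈ hs, h.coeff 1 = (e h : R)) (hsort : hs.Pairwise (fun h h' => e h' ≤ e h))
    (hB : ∀ k, (operatorOf hs).coeff k ∈ seriesIn B) : ∀ h ∈ hs, h ∈ seriesIn B := by
  induction hs with
  | nil => simp
  | cons h hs ih =>
    rw [List.pairwise_cons] at hsort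
    have hh : h ∈ seriesIn B := by
      intro j
      induction hn : j.toNat using Nat.strong_induction_on generalizing j with
      | _ n ihn =>
      by_cases hj0 : j < 1
      · rw [h0 h (by simp) j hj0]; exact zero_mem _
      by_cases hj1 : j = 1
      · rw [hj1, h1 h (by simp)]; exact intCast_mem _ _
      -- Only the terms of `h` before the one in question are known to be in `B`.
      set g : SeriesAtInfty R := HahnSeries.truncLT j h with hgdef
      have hgc : ∀ i, g.coeff i = if i < j then h.coeff i else 0 := fun i => by
        rw [hgdef, HahnSeries.coeff_truncLT]
      have hg : g ∈ seriesIn B := by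
        intro i
        rw [hgc]
        split_ifs with hi
        · by_cases hi0 : i < 1
          · rw [h0 h (by simp) i hi0]; exact zero_mem _
          · exact ihn i.toNat (by omega) i rfl
        · exact zero_mem _
      have key := leftRem_operatorOf g 1 (h :: hs)
      rw [List.foldl_cons] at key
      have hg0 : ∀ i < 1, g.coeff i = 0 := fun i hi => by
        rw [hgc, if_pos (by omega), h0 h (by simp) i hi]
      obtain ⟨m, hm, hm'⟩ := foldl_leading g hs e (e h)
        (fun k hk i hi => by
          rw [HahnSeries.coeff_sub, hg0 i hi, h0 k (List.mem_cons_of_mem _ hk) i hi, sub_zero])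
        (fun k hk => by
          rw [HahnSeries.coeff_sub, hgc, if_pos (by omega), h1 h (by simp),
            h1 k (List.mem_cons_of_mem _ hk)]
          push_cast; ring)
        hsort.1 ((g - h) * 1 - du 1) j (by omega)
        (fun i hi => by
          rw [du_one, mul_one, sub_zero, HahnSeries.coeff_sub, hgc, if_pos hi, sub_self])
      have hmem := leftRem_mem hg ((h :: hs).length + 1)
        (a := fun k => 1 * (operatorOf (h :: hs)).coeff k) (fun k => by rw [one_mul]; exact hB k)
        (j + hs.length)
      rw [key, hm'] at hmem
      have := mem_of_intCast_mul_mem hm.ne' hmem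
      rw [du_one, mul_one, sub_zero, HahnSeries.coeff_sub, hgc, if_neg (lt_irrefl _),
        zero_sub] at this
      exact neg_mem_iff.1 this
    -- Comparing coefficients in `(d/du - h) Q` from the top down gives those of `Q`.
    have hQ : ∀ d k, k + d = hs.length → (operatorOf hs).coeff k ∈ seriesIn B := by
      intro d
      induction d with
      | zero =>
        intro k hk
        rw [operatorOf_coeff_of_length_le _ _ (by omega)]
        split_ifs
        exacts [one_mem _, zero_mem _]
      | succ d ihd =>
        intro k hk
        have e1 := firstOrderMul_coeff h (operatorOf hs) (k + 1)
        rw [if_neg (by omega), Nat.add_sub_cancel, ← operatorOf_cons] at e1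
        have e2 : (operatorOf hs).coeff k = (operatorOf (h :: hs)).coeff (k + 1) -
            du ((operatorOf hs).coeff (k + 1)) + h * (operatorOf hs).coeff (k + 1) := by
          rw [e1]; ring
        have e3 := ihd (k + 1) (by omega)
        rw [e2]
        exact add_mem (sub_mem (hB _) (du_mem_seriesIn e3)) (mul_mem hh e3)
    have hQ' : ∀ k, (operatorOf hs).coeff k ∈ seriesIn B := by
      intro k
      by_cases hk : k ≤ hs.length
      · exact hQ (hs.length - k) k (by omega)
      · rw [operatorOf_coeff_of_length_le _ _ (by omega), if_neg (by omega)]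
        exact zero_mem _
    have := ih (fun k hk => h0 k (List.mem_cons_of_mem _ hk))
      (fun k hk => h1 k (List.mem_cons_of_mem _ hk)) hsort.2 hQ'
    intro k hk
    rcases List.mem_cons.1 hk with rfl | hk
    exacts [hh, this k hk]

end Operators

/-! ### Power sums and elementary symmetric functions -/

section PowerSums

variable {R : Type*} [CommRing R] [Algebra ℂ R]

/-- By Newton's identities, the power sums of a family generate its elementary symmetric functions. -/
theorem aeval_esymm_mem {B : Subalgebra ℂ R} {ι : Type*} [Fintype ι] (f : ι → R)
    (hf : ∀ j : ℕ, ∑ x, f x ^ j ∈ B) (k : ℕ) :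
    MvPolynomial.aeval f (MvPolynomial.esymm ι ℂ k) ∈ B := by
  classical
  induction k using Nat.strong_induction_on with
  | _ k ih =>
  by_cases hk : k = 0
  · subst hk; simp [one_mem]
  have h := congrArg (MvPolynomial.aeval f) (MvPolynomial.mul_esymm_eq_sum ι ℂ k)
  have hmem : MvPolynomial.aeval f ((k : MvPolynomial ι ℂ) * MvPolynomial.esymm ι ℂ k) ∈ B := by
    rw [h, map_mul, map_sum]
    refine mul_mem ?_ (sum_mem fun a ha => ?_)
    · rw [map_pow, map_neg, map_one]
      exact pow_mem (neg_mem (one_mem _)) _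
    · rw [map_mul, map_mul, map_pow, map_neg, map_one]
      refine mul_mem (mul_mem (pow_mem (neg_mem (one_mem _)) _)
        (ih _ (Finset.mem_filter.1 ha).2)) ?_
      rw [MvPolynomial.psum, map_sum]
      simpa using hf a.2
  rw [map_mul, map_natCast] at hmem
  exact mem_of_intCast_mul_mem (m := (k : ℤ)) (by exact_mod_cast hk) (by simpa using hmem)

theorem coeff_prod_X_sub_C_mem {B : Subalgebra ℂ R} {ι : Type*} [Fintype ι] (f : ι → R)
    (hf : ∀ j : ℕ, ∑ x, f x ^ j ∈ B) (k : ℕ) :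
    (∏ x, (Polynomial.X - Polynomial.C (f x))).coeff k ∈ B := by
  have e : ∏ x, (Polynomial.X - Polynomial.C (f x)) =
      ((Finset.univ.val.map f).map fun r => Polynomial.X - Polynomial.C r).prod := by
    rw [Multiset.map_map]; rfl
  by_cases hk : k ≤ Multiset.card (Finset.univ.val.map f)
  · rw [e, Multiset.prod_X_sub_C_coeff _ hk, ← MvPolynomial.aeval_esymm_eq_multiset_esymm ι ℂ]
    exact mul_mem (pow_mem (neg_mem (one_mem _)) _) (aeval_esymm_mem f hf _)
  · rw [Polynomial.coeff_eq_zero_of_natDegree_lt]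
    · exact zero_mem _
    · refine lt_of_le_of_lt (Polynomial.natDegree_prod_le _ _) ?_
      refine lt_of_le_of_lt (Finset.sum_le_card_nsmul _ _ 1 fun x _ =>
        Polynomial.natDegree_X_sub_C_le _) ?_
      simpa using hk

end PowerSums

/-! ### The factors of `D_Φ` -/

section Factors

variable {N n : ℕ} (lam : Fin n → Weight N) (l : Fin N → ℕ) (z : Fin n → ℂ)

theorem pairing_simpleRoot (a : Weight N) (i : Fin N) :
    pairing a (simpleRoot i) = a i.castSucc - a i.succ := by
  simp [pairing, simpleRoot, mul_sub, Finset.sum_sub_distrib, Pi.single_apply]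

theorem pairing_simpleRoot_nonneg {a : Weight N} (ha : Antitone a) (i : Fin N) :
    0 ≤ pairing a (simpleRoot i) := by
  rw [pairing_simpleRoot]
  have := ha (Fin.castSucc_lt_succ (i := i)).le
  omega

theorem sum_filter_level {M : Type*} [AddCommMonoid M] (f : Var l → M) (i : Fin N) :
    ∑ x : Var l with x.1.val + 1 = i.val + 1, f x = ∑ j, f ⟨i, j⟩ := by
  rw [Finset.sum_filter, Fintype.sum_sigma, Finset.sum_eq_single i]
  · simp
  · intro b _ hb
    exact Finset.sum_eq_zero fun j _ => if_neg fun h => hb (Fin.ext (by simpa using h))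
  · simp

/-- The sum of the `j`-th powers of the variables of color `k`, with `k = 1, …, N`. -/
def levelPsum (k j : ℕ) : Poly (Var l) := ∑ x : Var l with x.1.val + 1 = k, MvPolynomial.X x ^ j

theorem isUnit_logDu_ypoly (k : ℕ) : IsUnit (expandAtInfty (ypoly l k)) ∧
    ∀ j : ℤ, (logDu (expandAtInfty (ypoly l k))).coeff j =
      if 1 ≤ j then levelPsum l k (j - 1).toNat else 0 := by
  have h := logDu_prod (R := Poly (Var l)) (Finset.univ.filter fun x : Var l => x.1.val + 1 = k)
    (fun x => expandAtInfty (Polynomial.X - Polynomial.C (MvPolynomial.X x)))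
    (fun x _ => isUnit_expandAtInfty_X_sub_C _)
  rw [← map_prod] at h
  refine ⟨h.1, fun j => ?_⟩
  rw [ypoly, h.2, HahnSeries.coeff_sum]
  simp only [logDu_X_sub_C_coeff, levelPsum]
  split_ifs
  · rfl
  · exact Finset.sum_const_zero

theorem isUnit_logDu_Tpoly (i : Fin N) : IsUnit (expandAtInfty (Tpoly lam l z i)) ∧
    ∀ j : ℤ, (logDu (expandAtInfty (Tpoly lam l z i))).coeff j = if 1 ≤ j then
      ∑ s, (pairing (lam s) (simpleRoot i)).toNat •
        (MvPolynomial.C (z s) : Poly (Var l)) ^ (j - 1).toNat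
      else 0 := by
  have h := logDu_prod (R := Poly (Var l)) Finset.univ
    (fun s => expandAtInfty (Polynomial.X - Polynomial.C (MvPolynomial.C (z s))) ^
      (pairing (lam s) (simpleRoot i)).toNat)
    (fun x _ => (isUnit_expandAtInfty_X_sub_C _).pow _)
  simp only [← map_pow] at h
  rw [← map_prod] at h
  refine ⟨h.1, fun j => ?_⟩
  rw [Tpoly, h.2, HahnSeries.coeff_sum]
  simp only [map_pow, logDu_pow (isUnit_expandAtInfty_X_sub_C _), HahnSeries.coeff_smul,
    logDu_X_sub_C_coeff]
  split_ifs
  · rfl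
  · simp

/-- The coefficients of `log' (y_k T_{k+1} ⋯ T_N / y_{k+1})` are, up to constants, differences of
power sums of the variables of two consecutive colors. -/
theorem logDu_factorFun_coeff (k : ℕ) (j : ℤ) :
    (logDu (factorFun lam l z k)).coeff j = if 1 ≤ j then
      levelPsum l k (j - 1).toNat +
      (∑ i : Fin N with k ≤ i.val, ∑ s, (pairing (lam s) (simpleRoot i)).toNat •
        (MvPolynomial.C (z s) : Poly (Var l)) ^ (j - 1).toNat) -
      levelPsum l (k + 1) (j - 1).toNat else 0 := by
  have hy := isUnit_logDu_ypoly l k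
  have hy' := isUnit_logDu_ypoly l (k + 1)
  have hT := logDu_prod (R := Poly (Var l)) (Finset.univ.filter fun i : Fin N => k ≤ i.val)
    (fun i => expandAtInfty (Tpoly lam l z i)) (fun i _ => (isUnit_logDu_Tpoly lam l z i).1)
  rw [factorFun, map_mul, map_prod, logDu_mul (hy.1.mul hT.1) hy'.1.ringInverse,
    logDu_mul hy.1 hT.1, logDu_inverse hy'.1, hT.2, HahnSeries.coeff_add, HahnSeries.coeff_add,
    HahnSeries.coeff_neg, HahnSeries.coeff_sum, hy.2, hy'.2]
  simp only [(isUnit_logDu_Tpoly lam l z _).2]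
  split_ifs
  · ring
  · simp

theorem sum_filter_pairing (a : Weight N) (hlast : a (Fin.last N) = 0) (k : Fin (N + 1)) :
    ∑ i : Fin N with k.val ≤ i.val, pairing a (simpleRoot i) = a k := by
  induction k using Fin.reverseInduction with
  | last =>
    rw [hlast, Finset.filter_false_of_mem, Finset.sum_empty]
    intro i _
    simp
  | cast k ih =>
    have e : (Finset.univ.filter fun i : Fin N => k.castSucc.val ≤ i.val) =
        insert k (Finset.univ.filter fun i : Fin N => k.succ.val ≤ i.val) := by
      ext i
      simp only [Finset.mem_filter, Finset.mem_univ, true_and, Finset.mem_insert, Fin.ext_iff,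
        Fin.val_castSucc, Fin.val_succ]
      omega
    rw [e, Finset.sum_insert (by simp), ih, pairing_simpleRoot]
    ring

theorem levelPsum_zero_exponent (k : ℕ) :
    levelPsum l k 0 =
      ((∑ i : Fin N, if i.val + 1 = k then (l i : ℤ) else 0 : ℤ) : Poly (Var l)) := by
  rw [levelPsum, Finset.sum_filter, Fintype.sum_sigma]
  push_cast
  refine Finset.sum_congr rfl fun i _ => ?_
  split_ifs <;> simp

theorem weightInfty_apply (k : Fin (N + 1)) :
    weightInfty lam l k = ∑ s, lam s k + (∑ i : Fin N, if i.val + 1 = k.val then (l i : ℤ) else 0) -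
      ∑ i : Fin N, if i.val + 1 = k.val + 1 then (l i : ℤ) else 0 := by
  have : ∀ i : Fin N, ((l i : ℤ) • simpleRoot i) k =
      (if i.val + 1 = k.val + 1 then (l i : ℤ) else 0) -
        if i.val + 1 = k.val then (l i : ℤ) else 0 := by
    intro i
    simp only [simpleRoot, Pi.smul_apply, Pi.sub_apply, Pi.single_apply, smul_eq_mul, mul_sub,
      mul_ite, mul_one, mul_zero, Fin.ext_iff, Fin.val_castSucc, Fin.val_succ, eq_comm (a := k.val),
      Nat.add_right_cancel_iff]
  rw [weightInfty, Pi.sub_apply, Finset.sum_apply, Finset.sum_apply]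
  simp only [this, Finset.sum_sub_distrib]
  ring

/-- The exponent at infinity of `y_k T_{k+1} ⋯ T_N / y_{k+1}` is the `(k+1)`-st part of `λ^(∞)`. -/
theorem logDu_factorFun_coeff_one (hlam : ∀ s, IsPartition (lam s))
    (hlast : ∀ s, lam s (Fin.last N) = 0) (k : Fin (N + 1)) :
    (logDu (factorFun lam l z k)).coeff 1 = ((weightInfty lam l k : ℤ) : Poly (Var l)) := by
  rw [logDu_factorFun_coeff, if_pos le_rfl, weightInfty_apply]
  have e : ∑ i : Fin N with k.val ≤ i.val, ∑ s, (pairing (lam s) (simpleRoot i)).toNat •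
      (MvPolynomial.C (z s) : Poly (Var l)) ^ (1 - 1 : ℤ).toNat =
      ((∑ s, lam s k : ℤ) : Poly (Var l)) := by
    rw [Finset.sum_comm]
    push_cast
    refine Finset.sum_congr rfl fun s _ => ?_
    rw [← sum_filter_pairing (lam s) (hlast s) k]
    push_cast
    refine Finset.sum_congr rfl fun i _ => ?_
    rw [pow_zero, nsmul_one, ← Int.cast_natCast,
      Int.toNat_of_nonneg (pairing_simpleRoot_nonneg (hlam s).1 i)]
  rw [e]
  simp only [sub_self, Int.toNat_zero, levelPsum_zero_exponent]
  push_cast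
  ring

/-- The subalgebra of `ℂ[t]` generated by the `G_ij`. -/
def algebraG : Subalgebra ℂ (Poly (Var l)) :=
  Algebra.adjoin ℂ {x | ∃ i j : ℕ, 1 ≤ i ∧ i ≤ N + 1 ∧ i ≤ j ∧ x = coeffG lam l z i j}

theorem operatorDPhi_eq : operatorDPhi lam l z =
    operatorOf ((List.range (N + 1)).map fun k => logDu (factorFun lam l z k)) := by
  rw [operatorOf, List.foldr_map]; rfl

theorem operatorDPhi_coeff_mem (k : ℕ) :
    (operatorDPhi lam l z).coeff k ∈ seriesIn (algebraG lam l z) := by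
  intro j
  by_cases hk : N + 1 ≤ k
  · rw [operatorDPhi_eq, operatorOf_coeff_of_length_le _ _ (by simpa using hk)]
    split_ifs
    exacts [(one_mem (seriesIn (algebraG lam l z)) :) j, zero_mem _]
  -- Only the `G_ij` with `j ≥ i` are generators; the others vanish.
  by_cases hj : j + k < (N + 1 : ℕ)
  · rw [operatorDPhi_eq, operatorOf_coeff_coeff_eq_zero _ _ _ _ (by simpa using hj)]
    · exact zero_mem _
    · intro h hh i hi
      obtain ⟨k, _, rfl⟩ := List.mem_map.1 hh
      rw [logDu_factorFun_coeff, if_neg (by omega)]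
  · refine Algebra.subset_adjoin ⟨N + 1 - k, j.toNat, by omega, by omega, by omega, ?_⟩
    rw [coeffG, Int.toNat_of_nonneg (by omega)]
    congr 2
    omega

theorem levelPsum_mem (hlam : ∀ s, IsPartition (lam s)) (hlast : ∀ s, lam s (Fin.last N) = 0)
    (hinf : IsPartition (weightInfty lam l)) (k j : ℕ) (hk : k ≤ N + 1) :
    levelPsum l k j ∈ algebraG lam l z := by
  -- The exponents are attached to the series themselves, by reading off the coefficient of `u⁻¹`.
  have hfac : ∀ k < N + 1, logDu (factorFun lam l z k) ∈ seriesIn (algebraG lam l z) := by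
    have hinv : ∀ m : ℤ, Function.invFun (Int.cast : ℤ → Poly (Var l)) m = m :=
      Function.leftInverse_invFun Int.cast_injective
    have key := mem_of_operatorOf_mem (B := algebraG lam l z)
      (fun h => Function.invFun (Int.cast : ℤ → Poly (Var l)) (h.coeff 1))
      ((List.range (N + 1)).map fun k => logDu (factorFun lam l z k)) ?_ ?_ ?_ ?_
    · exact fun k hk => key _ (List.mem_map.2 ⟨k, List.mem_range.2 hk, rfl⟩)
    · intro h hh i hi
      obtain ⟨k, _, rfl⟩ := List.mem_map.1 hh
      rw [logDu_factorFun_coeff, if_neg (by omega)]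
    · intro h hh
      obtain ⟨k, hk, rfl⟩ := List.mem_map.1 hh
      have := logDu_factorFun_coeff_one lam l z hlam hlast ⟨k, List.mem_range.1 hk⟩
      simp only at this
      rw [this, hinv]
    · rw [List.pairwise_map]
      refine List.pairwise_lt_range.imp_of_mem fun {a b} ha hb hab => ?_
      have h1 := logDu_factorFun_coeff_one lam l z hlam hlast ⟨a, List.mem_range.1 ha⟩
      have h2 := logDu_factorFun_coeff_one lam l z hlam hlast ⟨b, List.mem_range.1 hb⟩
      simp only at h1 h2
      rw [h1, h2, hinv, hinv]
      exact hinf.1 (Fin.mk_le_mk.2 hab.le)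
    · rw [← operatorDPhi_eq]
      exact operatorDPhi_coeff_mem lam l z
  induction k with
  | zero =>
    rw [levelPsum, Finset.filter_false_of_mem (by simp), Finset.sum_empty]
    exact zero_mem _
  | succ k ih =>
    have h := hfac k (by omega) (j + 1)
    rw [logDu_factorFun_coeff, if_pos (by omega)] at h
    simp only [add_sub_cancel_right, Int.toNat_natCast] at h
    have h1 := ih (by omega)
    have h2 : ∑ i : Fin N with k ≤ i.val, ∑ s, (pairing (lam s) (simpleRoot i)).toNat •
        (MvPolynomial.C (z s) : Poly (Var l)) ^ j ∈ algebraG lam l z :=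
      sum_mem fun i _ => sum_mem fun s _ =>
        nsmul_mem (pow_mem (Subalgebra.algebraMap_mem (algebraG lam l z) (z s)) _) _
    have := sub_mem (add_mem h1 h2) h
    rwa [sub_sub_cancel] at this

/-- The coefficients of `y_1, …, y_N` are polynomials in the `G_ij`. -/
theorem coeff_prod_level_mem (hlam : ∀ s, IsPartition (lam s))
    (hlast : ∀ s, lam s (Fin.last N) = 0) (hinf : IsPartition (weightInfty lam l)) (i : Fin N)
    (k : ℕ) :
    (∏ j : Fin (l i), (Polynomial.X - Polynomial.C (MvPolynomial.X ⟨i, j⟩ : Poly (Var l)))).coeff k ∈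
      algebraG lam l z := by
  refine coeff_prod_X_sub_C_mem _ (fun j => ?_) k
  rw [← sum_filter_level l (fun x => (MvPolynomial.X x : Poly (Var l)) ^ j) i]
  exact levelPsum_mem lam l z hlam hlast hinf (i.val + 1) j (by omega)

end Factors

/-! ### The master function as a fraction -/

section MasterFunction

variable {N n : ℕ} (lam : Fin n → Weight N) (l : Fin N → ℕ) (z : Fin n → ℂ)

/-- The numerator of the master function. -/
def masterNum : Poly (Var l) :=
  ∏ i : Fin N, ∏ j : Fin (l i), ∏ j' : Fin (l i) with j < j',
    (MvPolynomial.X ⟨i, j⟩ - MvPolynomial.X ⟨i, j'⟩) ^ 2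

/-- The denominator of the master function; the exponents `(λ^(s), α_i)` are nonnegative when the
`λ^(s)` are partitions. -/
def masterDen : Poly (Var l) :=
  (∏ i : Fin N, ∏ i' : Fin N with i'.val = i.val + 1, ∏ j : Fin (l i), ∏ j' : Fin (l i'),
    (MvPolynomial.X ⟨i, j⟩ - MvPolynomial.X ⟨i', j'⟩)) *
  ∏ i : Fin N, ∏ j : Fin (l i), ∏ s : Fin n,
    (MvPolynomial.X ⟨i, j⟩ - MvPolynomial.C (z s)) ^ (pairing (lam s) (simpleRoot i)).toNat

theorem masterFunction_eq (hlam : ∀ s, IsPartition (lam s)) :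
    masterFunction lam l z = toRat (masterNum l) / toRat (masterDen lam l z) := by
  have hC : ∀ c : ℂ, algebraMap ℂ (RatField (Var l)) c = toRat (MvPolynomial.C c) := fun c => by
    rw [toRat, ← MvPolynomial.algebraMap_eq, ← IsScalarTower.algebraMap_apply]
  have hz : ∀ (x : RatField (Var l)) (s : Fin n) (i : Fin N),
      x ^ (-pairing (lam s) (simpleRoot i)) =
        (x ^ (pairing (lam s) (simpleRoot i)).toNat)⁻¹ := fun x s i => by
    rw [zpow_neg, ← zpow_natCast,
      Int.toNat_of_nonneg (pairing_simpleRoot_nonneg (hlam s).1 i)]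
  rw [masterFunction, masterNum, masterDen, div_eq_mul_inv, toRat_mul, mul_inv, mul_assoc]
  simp only [hz, hC, tvar, toRat, map_prod, map_sub, map_pow, Finset.prod_inv_distrib]

variable {lam l z}

/-- A substitution that preserves the values at a point where the master function is well-defined
and nonzero cannot kill just one of the numerator and the denominator. -/
theorem subst_masterNum_eq_zero_iff (hlam : ∀ s, IsPartition (lam s)) {p : Var l → ℂ}
    (hp : p ∈ domainU lam l z) (φ : Poly (Var l) →ₐ[ℂ] Poly (Var l))
    (hφ : ∀ f, MvPolynomial.eval p (φ f) = MvPolynomial.eval p f) :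
    φ (masterNum l) = 0 ↔ φ (masterDen lam l z) = 0 := by
  obtain ⟨v, hv, a, b, hb, hab, rfl⟩ := hp
  have ha : MvPolynomial.eval p a ≠ 0 := fun h => hv (by simp [h])
  rw [masterFunction_eq lam l z hlam] at hab
  have hD : toRat (masterDen lam l z) ≠ 0 := fun h => by
    rw [h, div_zero] at hab
    exact div_ne_zero (toRat_ne_zero ha) (toRat_ne_zero hb) hab.symm
  rw [div_eq_div_iff hD (toRat_ne_zero hb), ← toRat_mul, ← toRat_mul] at hab
  have h := congrArg φ (toRat_injective hab)
  rw [map_mul, map_mul] at h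
  have ha' : φ a ≠ 0 := fun h => ha (by rw [← hφ, h, map_zero])
  have hb' : φ b ≠ 0 := fun h => hb (by rw [← hφ, h, map_zero])
  constructor
  · intro h0
    rw [h0, zero_mul] at h
    exact (mul_eq_zero.1 h.symm).resolve_left ha'
  · intro h0
    rw [h0, mul_zero] at h
    exact (mul_eq_zero.1 h).resolve_right hb'

theorem X_sub_X_ne_zero {σ : Type*} {a b : σ} (h : a ≠ b) :
    (MvPolynomial.X a - MvPolynomial.X b : Poly σ) ≠ 0 :=
  sub_ne_zero.2 fun e => h (MvPolynomial.X_injective e)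

theorem X_sub_C_ne_zero {σ : Type*} (a : σ) (c : ℂ) :
    (MvPolynomial.X a - MvPolynomial.C c : Poly σ) ≠ 0 := by
  intro e
  have := congrArg (MvPolynomial.eval fun _ => c + 1) e
  simp at this

theorem eval_aeval_update {σ : Type*} [DecidableEq σ] {p : σ → ℂ} {a : σ} {q : Poly σ}
    (hq : MvPolynomial.eval p q = p a) (f : Poly σ) :
    MvPolynomial.eval p (MvPolynomial.aeval (Function.update MvPolynomial.X a q) f) =
      MvPolynomial.eval p f := by
  induction f using MvPolynomial.induction_on with
  | C c => simp
  | add f g hf hg => rw [map_add, map_add, hf, hg, map_add]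
  | mul_X f x hf =>
    rw [map_mul, map_mul, hf, map_mul, MvPolynomial.aeval_X]
    by_cases hx : x = a
    · subst hx; simp [hq]
    · simp [Function.update_of_ne hx]

/-- If `t_j = t_j'` at `p` for two variables of the same color, then substituting one for the other
kills the numerator, but no factor of the denominator. -/
theorem eval_masterNum_ne_zero (hlam : ∀ s, IsPartition (lam s)) {p : Var l → ℂ}
    (hp : p ∈ domainU lam l z) : MvPolynomial.eval p (masterNum l) ≠ 0 := by
  classical
  intro h
  simp only [masterNum, map_prod, Finset.prod_eq_zero_iff, Finset.mem_univ, true_and,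
    Finset.mem_filter, map_pow, map_sub, MvPolynomial.eval_X] at h
  obtain ⟨i, j, j', hj, h⟩ := h
  have h : p ⟨i, j'⟩ = p ⟨i, j⟩ := (sub_eq_zero.1 (pow_eq_zero_iff two_ne_zero |>.1 h)).symm
  set σ : Var l → Var l := Function.update id ⟨i, j⟩ ⟨i, j'⟩ with hσ
  have hσ1 : ∀ x, (σ x).1 = x.1 := by
    intro x
    by_cases hx : x = ⟨i, j⟩
    · subst hx; simp [hσ]
    · simp [hσ, Function.update_of_ne hx]
  let φ := MvPolynomial.aeval (R := ℂ) (Function.update (MvPolynomial.X : Var l → Poly (Var l))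
    ⟨i, j⟩ (MvPolynomial.X ⟨i, j'⟩))
  have hφX : ∀ x, φ (MvPolynomial.X x) = MvPolynomial.X (σ x) := by
    intro x
    simp only [φ, MvPolynomial.aeval_X]
    by_cases hx : x = ⟨i, j⟩
    · subst hx; simp [hσ]
    · simp [hσ, Function.update_of_ne hx]
  have key := (subst_masterNum_eq_zero_iff hlam hp φ (eval_aeval_update (by simpa using h))).1 (by
    rw [masterNum, map_prod]
    refine Finset.prod_eq_zero (Finset.mem_univ i) ?_
    rw [map_prod]
    refine Finset.prod_eq_zero (Finset.mem_univ j) ?_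
    rw [map_prod]
    refine Finset.prod_eq_zero (Finset.mem_filter.2 ⟨Finset.mem_univ j', hj⟩) ?_
    have e1 : (⟨i, j'⟩ : Var l) ≠ ⟨i, j⟩ := fun e => hj.ne' (by simpa using e)
    rw [map_pow, map_sub, hφX, hφX, hσ, Function.update_self, Function.update_of_ne e1, id,
      sub_self, zero_pow two_ne_zero])
  have hC : ∀ c, φ (MvPolynomial.C c) = MvPolynomial.C c := fun c => φ.commutes c
  simp only [masterDen, map_mul, map_prod, map_pow, map_sub, mul_eq_zero, Finset.prod_eq_zero_iff,
    Finset.mem_univ, true_and, Finset.mem_filter, hφX, hC] at key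
  rcases key with ⟨a, b, hab, c, d, e⟩ | ⟨a, c, s, e⟩
  · refine X_sub_X_ne_zero (fun e' => ?_) e
    have := congrArg (fun x => x.1.val) e'
    simp only [hσ1] at this
    omega
  · exact X_sub_C_ne_zero _ _ (eq_zero_of_pow_eq_zero e)

/-- If a factor of the denominator vanishes at `p`, then eliminating one of its variables kills the
denominator, but no factor of the numerator. -/
theorem eval_masterDen_ne_zero (hlam : ∀ s, IsPartition (lam s)) {p : Var l → ℂ}
    (hp : p ∈ domainU lam l z) : MvPolynomial.eval p (masterDen lam l z) ≠ 0 := by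
  classical
  intro h
  simp only [masterDen, map_mul, mul_eq_zero, map_prod, Finset.prod_eq_zero_iff, Finset.mem_univ,
    true_and, Finset.mem_filter, map_pow, map_sub, MvPolynomial.eval_X, MvPolynomial.eval_C] at h
  rcases h with ⟨i, i', hi, j, j', h⟩ | ⟨i, j, s, h⟩
  · have h : p ⟨i', j'⟩ = p ⟨i, j⟩ := (sub_eq_zero.1 h).symm
    have hne : (⟨i', j'⟩ : Var l) ≠ ⟨i, j⟩ := fun e => by
      have := congrArg (fun x => x.1.val) e
      simp only at this
      omega
    have key := (subst_masterNum_eq_zero_iff hlam hp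
      (MvPolynomial.aeval (Function.update MvPolynomial.X ⟨i, j⟩ (MvPolynomial.X ⟨i', j'⟩)))
      (eval_aeval_update (by simpa using h))).2 (by
        rw [masterDen, map_mul, map_prod]
        refine mul_eq_zero_of_left (Finset.prod_eq_zero (Finset.mem_univ i) ?_) _
        rw [map_prod]
        refine Finset.prod_eq_zero (Finset.mem_filter.2 ⟨Finset.mem_univ i', hi⟩) ?_
        rw [map_prod]
        refine Finset.prod_eq_zero (Finset.mem_univ j) ?_
        rw [map_prod]
        refine Finset.prod_eq_zero (Finset.mem_univ j') ?_
        rw [map_sub, MvPolynomial.aeval_X, MvPolynomial.aeval_X, Function.update_self,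
          Function.update_of_ne hne, sub_self])
    simp only [masterNum, map_prod, map_pow, map_sub, Finset.prod_eq_zero_iff, Finset.mem_univ,
      true_and, Finset.mem_filter, MvPolynomial.aeval_X] at key
    obtain ⟨k, a, b, hab, e⟩ := key
    replace e := eq_zero_of_pow_eq_zero e
    have hab' : (⟨k, a⟩ : Var l) ≠ ⟨k, b⟩ := fun e => hab.ne (by simpa using e)
    by_cases ha : (⟨k, a⟩ : Var l) = ⟨i, j⟩
    · rw [ha, Function.update_self, Function.update_of_ne (ha ▸ hab'.symm)] at e
      refine X_sub_X_ne_zero (fun e' => ?_) e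
      have h1 := congrArg (fun x => x.1.val) e'
      have h2 := congrArg (fun x => x.1.val) ha
      simp only at h1 h2
      omega
    · rw [Function.update_of_ne ha] at e
      by_cases hb : (⟨k, b⟩ : Var l) = ⟨i, j⟩
      · rw [hb, Function.update_self] at e
        refine X_sub_X_ne_zero (fun e' => ?_) e
        have h1 := congrArg (fun x => x.1.val) e'
        have h2 := congrArg (fun x => x.1.val) hb
        simp only at h1 h2
        omega
      · rw [Function.update_of_ne hb] at e
        exact X_sub_X_ne_zero hab' e
  · have hpow : (pairing (lam s) (simpleRoot i)).toNat ≠ 0 := fun h0 => by simp [h0] at h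
    replace h : z s = p ⟨i, j⟩ := (sub_eq_zero.1 (eq_zero_of_pow_eq_zero h)).symm
    have key := (subst_masterNum_eq_zero_iff hlam hp
      (MvPolynomial.aeval (Function.update MvPolynomial.X ⟨i, j⟩ (MvPolynomial.C (z s))))
      (eval_aeval_update (by simpa using h))).2 (by
        rw [masterDen, map_mul]
        refine mul_eq_zero_of_right _ ?_
        rw [map_prod]
        refine Finset.prod_eq_zero (Finset.mem_univ i) ?_
        rw [map_prod]
        refine Finset.prod_eq_zero (Finset.mem_univ j) ?_
        rw [map_prod]
        refine Finset.prod_eq_zero (Finset.mem_univ s) ?_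
        rw [map_pow, map_sub, MvPolynomial.aeval_X, Function.update_self,
          ← MvPolynomial.algebraMap_eq, AlgHom.commutes, sub_self, zero_pow hpow])
    simp only [masterNum, map_prod, map_pow, map_sub, Finset.prod_eq_zero_iff, Finset.mem_univ,
      true_and, Finset.mem_filter, MvPolynomial.aeval_X] at key
    obtain ⟨k, a, b, hab, e⟩ := key
    replace e := eq_zero_of_pow_eq_zero e
    have hab' : (⟨k, a⟩ : Var l) ≠ ⟨k, b⟩ := fun e => hab.ne (by simpa using e)
    by_cases ha : (⟨k, a⟩ : Var l) = ⟨i, j⟩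
    · rw [ha, Function.update_self, Function.update_of_ne (ha ▸ hab'.symm)] at e
      exact X_sub_C_ne_zero _ _ (by rw [← neg_sub, e, neg_zero])
    · rw [Function.update_of_ne ha] at e
      by_cases hb : (⟨k, b⟩ : Var l) = ⟨i, j⟩
      · rw [hb, Function.update_self] at e
        exact X_sub_C_ne_zero _ _ e
      · rw [Function.update_of_ne hb] at e
        exact X_sub_X_ne_zero hab' e

/-- The critical point equations, cleared of denominators. -/
theorem Psi_mul_eq (hlam : ∀ s, IsPartition (lam s)) (x : Var l) (hne : masterNum l ≠ 0)
    (hne' : masterDen lam l z ≠ 0) :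
    Psi lam l z x * (polyRegular (domainU lam l z) (masterNum l) *
        polyRegular (domainU lam l z) (masterDen lam l z)) =
      polyRegular (domainU lam l z) (MvPolynomial.pderiv x (masterNum l)) *
        polyRegular (domainU lam l z) (masterDen lam l z) -
      polyRegular (domainU lam l z) (masterNum l) *
        polyRegular (domainU lam l z) (MvPolynomial.pderiv x (masterDen lam l z)) := by
  apply Subtype.ext
  change logPDeriv x (masterFunction lam l z) * (toRat (masterNum l) * toRat (masterDen lam l z)) =
    toRat _ * toRat _ - toRat _ * toRat _
  rw [masterFunction_eq lam l z hlam, logPDeriv_div x hne hne']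
  have h1 : toRat (masterNum l) ≠ 0 := fun h => hne (toRat_injective (by simpa [toRat] using h))
  have h2 : toRat (masterDen lam l z) ≠ 0 :=
    fun h => hne' (toRat_injective (by simpa [toRat] using h))
  field_simp

end MasterFunction

/-! ### Logarithmic derivatives along escaping variables -/

section Euler

theorem valuation_div_sub_lt_one {K : Type*} [Field K] {O : ValuationSubring K} {x y : K}
    (hx : O.valuation x ≤ 1) (hy : 1 < O.valuation y) :
    O.valuation (x / (y - x)) < 1 := by
  have h := hx.trans_lt hy
  rw [map_div₀, Valuation.map_sub_eq_of_lt_left _ h]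
  exact (div_lt_one₀ (zero_lt_one.trans hy)).2 h

variable {σ : Type*} {K : Type*} [Field K] [Algebra ℂ K]

/-- The Euler operator `∑ x ∂/∂x` in a set `s` of variables. -/
def partialEuler (s : Finset σ) (f : Poly σ) : Poly σ :=
  ∑ x ∈ s, MvPolynomial.X x * MvPolynomial.pderiv x f

theorem partialEuler_mul (s : Finset σ) (f g : Poly σ) :
    partialEuler s (f * g) = partialEuler s f * g + f * partialEuler s g := by
  simp only [partialEuler, Derivation.leibniz, smul_eq_mul, Finset.sum_mul, Finset.mul_sum,
    ← Finset.sum_add_distrib]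
  exact Finset.sum_congr rfl fun x _ => by ring

theorem partialEuler_X [DecidableEq σ] (s : Finset σ) (a : σ) :
    partialEuler s (MvPolynomial.X a) = if a ∈ s then MvPolynomial.X a else 0 := by
  simp only [partialEuler, MvPolynomial.pderiv_X, Pi.single_apply, mul_ite, mul_one, mul_zero]
  rw [Finset.sum_ite_eq]

theorem partialEuler_sub (s : Finset σ) (f g : Poly σ) :
    partialEuler s (f - g) = partialEuler s f - partialEuler s g := by
  simp only [partialEuler, map_sub, mul_sub, Finset.sum_sub_distrib]

theorem partialEuler_C (s : Finset σ) (c : ℂ) : partialEuler s (MvPolynomial.C c : Poly σ) = 0 := by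
  simp [partialEuler]

/-- At the point `t`, the logarithmic derivative of `f` along the Euler field of the variables
in `s` is congruent to the integer `m` modulo the maximal ideal of the valuation ring `O`; that is,
`f` grows asymptotically like the `m`-th power of the scale of the variables in `s`. -/
def HasEscapeDegree (O : ValuationSubring K) (t : σ → K) (s : Finset σ) (f : Poly σ) (m : ℤ) :
    Prop :=
  MvPolynomial.aeval t f ≠ 0 ∧
    O.valuation (MvPolynomial.aeval t (partialEuler s f) / MvPolynomial.aeval t f - m) < 1

/-- An element of every valuation ring that contains the constants is algebraic over `ℂ`. -/
theorem isIntegral_of_forall_mem_valuationSubring {x : K}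
    (h : ∀ O : ValuationSubring K, Set.range (algebraMap ℂ K) ⊆ O → x ∈ O) : IsIntegral ℂ x := by
  have hcl : x ∈ (integralClosure (Subring.closure (Set.range (algebraMap ℂ K))) K).toSubring := by
    rw [← iInf_valuationSubring_superset]
    simp only [Subring.mem_iInf]
    exact fun O => h O.1 O.2
  -- The subring generated by the image of `ℂ` is that image, so the monic equation lifts to `ℂ[X]`.
  have hcl : IsIntegral (Subring.closure (Set.range (algebraMap ℂ K))) x := hcl
  obtain ⟨q, hq, hqx⟩ := hcl
  have hlift : q.map (algebraMap _ K) ∈ Polynomial.lifts (algebraMap ℂ K) := by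
    rw [Polynomial.lifts_iff_coeff_lifts]
    intro k
    rw [Polynomial.coeff_map]
    exact (Subring.closure_le (t := (algebraMap ℂ K).range)).2 subset_rfl (q.coeff k).2
  obtain ⟨p, hp, -, hpm⟩ := Polynomial.lifts_and_natDegree_eq_and_monic hlift (hq.map _)
  refine ⟨p, hpm, ?_⟩
  rw [← Polynomial.eval_map, hp, Polynomial.eval_map, hqx]

variable {O : ValuationSubring K} {t : σ → K} {s : Finset σ}

theorem HasEscapeDegree.one : HasEscapeDegree O t s 1 0 := by
  have h := partialEuler_C s (1 : ℂ)
  rw [map_one] at h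
  simp [HasEscapeDegree, h]

theorem HasEscapeDegree.mul {f g : Poly σ} {m k : ℤ} (hf : HasEscapeDegree O t s f m)
    (hg : HasEscapeDegree O t s g k) : HasEscapeDegree O t s (f * g) (m + k) := by
  refine ⟨by rw [map_mul]; exact mul_ne_zero hf.1 hg.1, ?_⟩
  have e : MvPolynomial.aeval t (partialEuler s (f * g)) / MvPolynomial.aeval t (f * g) -
      ((m + k : ℤ) : K) =
      (MvPolynomial.aeval t (partialEuler s f) / MvPolynomial.aeval t f - m) +
      (MvPolynomial.aeval t (partialEuler s g) / MvPolynomial.aeval t g - k) := by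
    have := hf.1
    have := hg.1
    rw [partialEuler_mul, map_add, map_mul, map_mul, map_mul]
    push_cast
    field_simp
    ring
  rw [e]
  exact Valuation.map_add_lt _ hf.2 hg.2

theorem HasEscapeDegree.prod {ι : Type*} (u : Finset ι) (f : ι → Poly σ) (m : ι → ℤ)
    (h : ∀ i ∈ u, HasEscapeDegree O t s (f i) (m i)) :
    HasEscapeDegree O t s (∏ i ∈ u, f i) (∑ i ∈ u, m i) := by
  classical
  induction u using Finset.induction_on with
  | empty => exact HasEscapeDegree.one
  | insert a u ha ih =>
    rw [Finset.prod_insert ha, Finset.sum_insert ha]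
    exact (h a (Finset.mem_insert_self a u)).mul
      (ih fun i hi => h i (Finset.mem_insert_of_mem hi))

theorem HasEscapeDegree.pow {f : Poly σ} {m : ℤ} (h : HasEscapeDegree O t s f m) (k : ℕ) :
    HasEscapeDegree O t s (f ^ k) (k * m) := by
  have := HasEscapeDegree.prod (Finset.range k) (fun _ => f) (fun _ => m) (fun _ _ => h)
  simpa using this

/-- The indicator of the set `s`. -/
def ind [DecidableEq σ] (s : Finset σ) (a : σ) : ℤ := if a ∈ s then 1 else 0

/-- If `a` escapes and `b` does not, `t_a / (t_a - t_b) = 1 + t_b / (t_a - t_b)` is congruent to `1`;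
if both escape, the logarithmic derivative is exactly `1`. -/
theorem hasEscapeDegree_X_sub_X [DecidableEq σ] (hs : ∀ x, x ∈ s ↔ 1 < O.valuation (t x)) {a b : σ}
    (hab : t a - t b ≠ 0) :
    HasEscapeDegree O t s (MvPolynomial.X a - MvPolynomial.X b)
      (ind s a + ind s b - ind s a * ind s b) := by
  refine ⟨by simpa using hab, ?_⟩
  rw [partialEuler_sub, partialEuler_X, partialEuler_X, ind, ind, map_sub (MvPolynomial.aeval (R := ℂ) t),
    map_sub (MvPolynomial.aeval (R := ℂ) t),
    MvPolynomial.aeval_X, MvPolynomial.aeval_X]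
  by_cases ha : a ∈ s <;> by_cases hb : b ∈ s
  · simp [ha, hb, div_self hab]
  · have h := valuation_div_sub_lt_one (not_lt.1 ((hs b).not.1 hb)) ((hs a).1 ha)
    simp only [ha, hb, if_true, if_false, MvPolynomial.aeval_X, map_zero, sub_zero, add_zero,
      mul_zero, Int.cast_one]
    convert! h using 2
    field_simp
    ring
  · have h := valuation_div_sub_lt_one (not_lt.1 ((hs a).not.1 ha)) ((hs b).1 hb)
    have hba : t b - t a ≠ 0 := sub_ne_zero.2 (sub_ne_zero.1 hab).symm
    simp only [ha, hb, if_true, if_false, MvPolynomial.aeval_X, map_zero, sub_zero, zero_add,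
      zero_mul, Int.cast_one]
    convert! h using 2
    field_simp
    ring
  · simp [ha, hb]

theorem hasEscapeDegree_X_sub_C [DecidableEq σ] (hO : ∀ c : ℂ, O.valuation (algebraMap ℂ K c) ≤ 1)
    (hs : ∀ x, x ∈ s ↔ 1 < O.valuation (t x)) {a : σ} {c : ℂ} (hac : t a - algebraMap ℂ K c ≠ 0) :
    HasEscapeDegree O t s (MvPolynomial.X a - MvPolynomial.C c) (ind s a) := by
  refine ⟨by simpa using hac, ?_⟩
  rw [partialEuler_sub, partialEuler_X, partialEuler_C, ind, map_sub (MvPolynomial.aeval (R := ℂ) t),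
    map_sub (MvPolynomial.aeval (R := ℂ) t),
    MvPolynomial.aeval_X, MvPolynomial.aeval_C]
  by_cases ha : a ∈ s
  · have h := valuation_div_sub_lt_one (hO c) ((hs a).1 ha)
    simp only [ha, if_true, MvPolynomial.aeval_X, map_zero, sub_zero, Int.cast_one]
    convert! h using 2
    field_simp
    ring
  · simp [ha]

/-- As the residue characteristic is zero, the degree is determined by the logarithmic
derivatives. -/
theorem HasEscapeDegree.unique (hO : ∀ c : ℂ, O.valuation (algebraMap ℂ K c) ≤ 1)
    {f g : Poly σ}
    {m k : ℤ} (hf : HasEscapeDegree O t s f m) (hg : HasEscapeDegree O t s g k)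
    (h : ∀ x, MvPolynomial.aeval t (MvPolynomial.pderiv x f) * MvPolynomial.aeval t g =
      MvPolynomial.aeval t f * MvPolynomial.aeval t (MvPolynomial.pderiv x g)) : m = k := by
  have e : MvPolynomial.aeval t (partialEuler s f) / MvPolynomial.aeval t f =
      MvPolynomial.aeval t (partialEuler s g) / MvPolynomial.aeval t g := by
    rw [div_eq_div_iff hf.1 hg.1]
    simp only [partialEuler, map_sum, map_mul, Finset.sum_mul]
    exact Finset.sum_congr rfl fun x _ => by
      linear_combination (MvPolynomial.aeval t (MvPolynomial.X x : Poly σ)) * h x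
  have h1 := Valuation.map_sub_lt _ hg.2 hf.2
  rw [e, sub_sub_sub_cancel_left] at h1
  by_contra hne
  have h2 : ((m - k : ℤ) : ℂ) ≠ 0 := Int.cast_ne_zero.2 (sub_ne_zero.2 hne)
  have h3 := hO ((m - k : ℤ) : ℂ)⁻¹
  have h4 := mul_lt_one_of_lt_of_le h1 h3
  rw [← map_mul, map_inv₀, map_intCast] at h4
  push_cast at h4
  have h5 : ((m : K) - k) ≠ 0 := by
    have := (map_ne_zero (algebraMap ℂ K)).2 h2
    rw [map_intCast] at this
    push_cast at this
    exact this
  rw [mul_inv_cancel₀ h5, map_one] at h4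
  exact lt_irrefl _ h4

end Euler

/-! ### The exponent of the master function at infinity -/

section Counting

theorem two_mul_sum_lt {m : ℕ} (F : Fin m → Fin m → ℤ) (hF : ∀ j j', F j j' = F j' j) :
    2 * ∑ j, ∑ j' with j < j', F j j' = ∑ j, ∑ j', F j j' - ∑ j, F j j := by
  have h : ∀ j, ∑ j', F j j' = ∑ j' with j < j', F j j' + ∑ j' with j' < j, F j j' + F j j := by
    intro j
    have : F j j = ∑ j', if j = j' then F j j' else 0 := by simp
    rw [this, Finset.sum_filter, Finset.sum_filter, ← Finset.sum_add_distrib,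
      ← Finset.sum_add_distrib]
    refine Finset.sum_congr rfl fun j' _ => ?_
    rcases lt_trichotomy j j' with h | h | h
    · simp [h, h.ne, h.not_gt]
    · simp [h]
    · simp [h, h.ne', h.not_gt]
  have h2 : ∑ j, ∑ j' with j' < j, F j j' = ∑ j, ∑ j' with j < j', F j j' := by
    simp only [Finset.sum_filter]
    rw [Finset.sum_comm]
    exact Finset.sum_congr rfl fun j _ => Finset.sum_congr rfl fun j' _ => by rw [hF]
  simp only [h, Finset.sum_add_distrib, h2]
  ring

theorem sum_sum_union {m m' : ℕ} (a : Fin m → ℤ) (b : Fin m' → ℤ) :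
    ∑ j, ∑ j', (a j + b j' - a j * b j') =
      (∑ j, a j) * m' + m * ∑ j', b j' - (∑ j, a j) * ∑ j', b j' := by
  simp only [Finset.sum_sub_distrib, Finset.sum_add_distrib, Finset.sum_const, Finset.card_univ,
    Fintype.card_fin, ← Finset.mul_sum, ← Finset.sum_mul, nsmul_eq_mul]
  ring

variable {N : ℕ}

theorem pairing_simpleRoot_simpleRoot (i j : Fin N) :
    pairing (simpleRoot i) (simpleRoot j) = 2 * (if i = j then 1 else 0) -
      (if j.val = i.val + 1 then 1 else 0) - (if i.val = j.val + 1 then 1 else 0) := by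
  rw [pairing_simpleRoot]
  simp only [simpleRoot, Pi.sub_apply, Pi.single_apply, Fin.ext_iff, Fin.val_castSucc, Fin.val_succ]
  split_ifs <;> omega

/-- The sum of `a_i b_{i+1}`. -/
def adjSum (a b : Fin N → ℤ) : ℤ := ∑ i, ∑ i' with i'.val = i.val + 1, a i * b i'

theorem sum_mul_pairing (a b : Fin N → ℤ) :
    ∑ i, ∑ j, a i * b j * pairing (simpleRoot i) (simpleRoot j) =
      2 * ∑ i, a i * b i - adjSum a b - adjSum b a := by
  simp only [pairing_simpleRoot_simpleRoot, mul_sub, Finset.sum_sub_distrib]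
  congr 1
  · congr 1
    · rw [Finset.mul_sum]
      refine Finset.sum_congr rfl fun i _ => ?_
      rw [Finset.sum_eq_single i]
      · simp; ring
      · intro j _ hj; simp [hj.symm]
      · simp
    · simp only [adjSum, Finset.sum_filter, mul_ite, mul_one, mul_zero]
  · rw [Finset.sum_comm]
    simp only [adjSum, Finset.sum_filter, mul_ite, mul_one, mul_zero, mul_comm (b _)]

theorem sum_mul_pairing_self_nonneg (a : Fin N → ℤ) :
    0 ≤ ∑ i, ∑ j, a i * a j * pairing (simpleRoot i) (simpleRoot j) := by
  have : ∑ i, ∑ j, a i * a j * pairing (simpleRoot i) (simpleRoot j) =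
      ∑ k, (∑ i, a i * simpleRoot i k) ^ 2 := by
    simp only [pairing, sq, Finset.sum_mul_sum]
    conv_rhs => rw [Finset.sum_comm]
    refine Finset.sum_congr rfl fun i _ => ?_
    conv_rhs => rw [Finset.sum_comm]
    refine Finset.sum_congr rfl fun j _ => ?_
    rw [Finset.mul_sum]
    exact Finset.sum_congr rfl fun k _ => by ring
  rw [this]
  exact Finset.sum_nonneg fun k _ => sq_nonneg _

theorem pairing_weightInfty {n : ℕ} (lam : Fin n → Weight N) (l : Fin N → ℕ) (i : Fin N) :
    pairing (weightInfty lam l) (simpleRoot i) = ∑ s, pairing (lam s) (simpleRoot i) -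
      ∑ j, (l j : ℤ) * pairing (simpleRoot j) (simpleRoot i) := by
  simp only [pairing_simpleRoot, weightInfty, Pi.sub_apply, Finset.sum_apply, Pi.smul_apply,
    smul_eq_mul, mul_sub, Finset.sum_sub_distrib]
  ring

/-- If `r_i` of the variables of color `i` escape to infinity, the master function grows with an
exponent equal to `-(λ^(∞), β) - (β, β) / 2 - ∑ r_i` with `β = ∑ r_i α_i`. As `λ^(∞)` is dominant,
this is negative unless all the `r_i` are zero. -/
theorem eq_zero_of_escape_exponent_eq_zero {n : ℕ} (lam : Fin n → Weight N) (l : Fin N → ℕ)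
    (hinf : IsPartition (weightInfty lam l)) (r : Fin N → ℤ) (hr : ∀ i, 0 ≤ r i)
    (h : ∑ i, (2 * (l i * r i) - r i ^ 2 - r i) =
      ∑ i, ∑ i' with i'.val = i.val + 1, (r i * l i' + l i * r i' - r i * r i') +
      ∑ i, r i * ∑ s, pairing (lam s) (simpleRoot i)) (i : Fin N) : r i = 0 := by
  have h1 : ∑ i, r i * ∑ s, pairing (lam s) (simpleRoot i) =
      ∑ i, r i * pairing (weightInfty lam l) (simpleRoot i) +
      ∑ j, ∑ i, (l j : ℤ) * r i * pairing (simpleRoot j) (simpleRoot i) := by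
    rw [Finset.sum_comm, ← Finset.sum_add_distrib]
    refine Finset.sum_congr rfl fun i _ => ?_
    rw [pairing_weightInfty, mul_sub]
    have : ∀ j, (l j : ℤ) * r i * pairing (simpleRoot j) (simpleRoot i) =
      r i * ((l j : ℤ) * pairing (simpleRoot j) (simpleRoot i)) := fun j => by ring
    simp only [this, ← Finset.mul_sum]
    ring
  have h2 : ∑ i, ∑ i' with i'.val = i.val + 1, (r i * l i' + l i * r i' - r i * r i') =
      adjSum r (fun i => (l i : ℤ)) + adjSum (fun i => (l i : ℤ)) r - adjSum r r := by
    simp only [adjSum, Finset.sum_sub_distrib, Finset.sum_add_distrib]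
  have h3 := sum_mul_pairing_self_nonneg r
  have h4 := sum_mul_pairing r r
  have h5 := sum_mul_pairing (fun i => (l i : ℤ)) r
  have h6 : 0 ≤ ∑ i, r i * pairing (weightInfty lam l) (simpleRoot i) :=
    Finset.sum_nonneg fun i _ => mul_nonneg (hr i) (pairing_simpleRoot_nonneg hinf.1 i)
  have h7 : ∑ i, r i ^ 2 = ∑ i, r i * r i := Finset.sum_congr rfl fun i _ => sq _
  have h8 : ∑ i, r i = 0 := by
    refine le_antisymm ?_ (Finset.sum_nonneg fun i _ => hr i)
    rw [h1, h2, h5] at h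
    simp only [Finset.sum_sub_distrib, ← Finset.mul_sum] at h
    linarith
  exact (Finset.sum_eq_zero_iff_of_nonneg fun i _ => hr i).1 h8 i (Finset.mem_univ i)

end Counting

/-! ### Critical points over extension fields -/

section Finiteness

variable {N n : ℕ} {lam : Fin n → Weight N} {l : Fin N → ℕ} {z : Fin n → ℂ}

/-- The coordinates of a critical point over an extension `K` of `ℂ` are algebraic over `ℂ`:
no subset of them can escape to infinity. -/
theorem isIntegral_of_critical {K : Type*} [Field K] [Algebra ℂ K]
    (hlam : ∀ s, IsPartition (lam s)) (hinf : IsPartition (weightInfty lam l)) (t : Var l → K)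
    (hnum : MvPolynomial.aeval t (masterNum l) ≠ 0)
    (hden : MvPolynomial.aeval t (masterDen lam l z) ≠ 0)
    (hcrit : ∀ x, MvPolynomial.aeval t (MvPolynomial.pderiv x (masterNum l)) *
        MvPolynomial.aeval t (masterDen lam l z) =
      MvPolynomial.aeval t (masterNum l) *
        MvPolynomial.aeval t (MvPolynomial.pderiv x (masterDen lam l z))) (x : Var l) :
    IsIntegral ℂ (t x) := by
  classical
  refine isIntegral_of_forall_mem_valuationSubring ?_
  intro O hO
  have hO' : ∀ c : ℂ, O.valuation (algebraMap ℂ K c) ≤ 1 := fun c =>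
    (O.valuation_le_one_iff _).2 (hO ⟨c, rfl⟩)
  -- `s` is the set of the coordinates with a pole, and `r i` of them have color `i`.
  set s : Finset (Var l) := Finset.univ.filter fun x => 1 < O.valuation (t x) with hsdef
  have hs : ∀ x, x ∈ s ↔ 1 < O.valuation (t x) := fun x => by simp [hsdef]
  set r : Fin N → ℤ := fun i => ∑ j : Fin (l i), ind s ⟨i, j⟩ with hr
  have hind : ∀ x, ind s x * ind s x = ind s x := fun x => by
    rw [ind]; split_ifs <;> rfl
  have hind0 : ∀ x, 0 ≤ ind s x := fun x => by
    rw [ind]; split_ifs <;> simp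
  have hnum' := hnum
  rw [masterNum] at hnum'
  simp only [map_prod, map_pow, map_sub, MvPolynomial.aeval_X, Finset.prod_ne_zero_iff,
    Finset.mem_univ, true_imp_iff, Finset.mem_filter, true_and] at hnum'
  have hden' := hden
  rw [masterDen] at hden'
  simp only [map_mul, map_prod, map_pow, map_sub, MvPolynomial.aeval_X, MvPolynomial.aeval_C,
    mul_ne_zero_iff, Finset.prod_ne_zero_iff, Finset.mem_univ, true_imp_iff, Finset.mem_filter,
    true_and] at hden'
  have h1 : HasEscapeDegree O t s (masterNum l) (∑ i : Fin N, ∑ j : Fin (l i), ∑ j' with j < j',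
      ((2 : ℕ) : ℤ) * (ind s ⟨i, j⟩ + ind s ⟨i, j'⟩ - ind s ⟨i, j⟩ * ind s ⟨i, j'⟩)) := by
    refine .prod _ _ _ fun i _ => .prod _ _ _ fun j _ => .prod _ _ _ fun j' hj => .pow ?_ 2
    refine hasEscapeDegree_X_sub_X hs ?_
    exact fun h => hnum' i j j' (Finset.mem_filter.1 hj).2 (by rw [h, zero_pow two_ne_zero])
  have h2 : HasEscapeDegree O t s (masterDen lam l z)
      ((∑ i : Fin N, ∑ i' : Fin N with i'.val = i.val + 1, ∑ j : Fin (l i), ∑ j' : Fin (l i'),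
        (ind s ⟨i, j⟩ + ind s ⟨i', j'⟩ - ind s ⟨i, j⟩ * ind s ⟨i', j'⟩)) +
      ∑ i : Fin N, ∑ j : Fin (l i), ∑ k,
        ((pairing (lam k) (simpleRoot i)).toNat : ℤ) * ind s ⟨i, j⟩) := by
    refine .mul ?_ ?_
    · refine .prod _ _ _ fun i _ => .prod _ _ _ fun i' hi => .prod _ _ _ fun j _ =>
        .prod _ _ _ fun j' _ => hasEscapeDegree_X_sub_X hs ?_
      exact hden'.1 i i' (Finset.mem_filter.1 hi).2 j j'
    · refine .prod _ _ _ fun i _ => .prod _ _ _ fun j _ => .prod _ _ _ fun k _ => ?_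
      -- A factor with exponent zero may vanish at `t`.
      by_cases hk : (pairing (lam k) (simpleRoot i)).toNat = 0
      · rw [hk, pow_zero]
        simpa using HasEscapeDegree.one
      · refine .pow (hasEscapeDegree_X_sub_C hO' hs fun h => hden'.2 i j k ?_) _
        rw [h, zero_pow hk]
  have h3 := h1.unique hO' h2 hcrit
  have key := eq_zero_of_escape_exponent_eq_zero lam l hinf r
    (fun i => Finset.sum_nonneg fun j _ => hind0 _) (by
      convert! h3 using 2
      · rename_i i _
        simp only [← Finset.mul_sum]
        rw [Nat.cast_ofNat, two_mul_sum_lt _ (fun j j' => by ring), sum_sum_union]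
        simp only [hind, add_sub_cancel_right]
        ring
      · refine Finset.sum_congr rfl fun i _ => Finset.sum_congr rfl fun i' _ => ?_
        rw [sum_sum_union]
      · refine Finset.sum_congr rfl fun i _ => ?_
        rw [Finset.sum_mul]
        refine Finset.sum_congr rfl fun j _ => ?_
        rw [Finset.mul_sum]
        refine Finset.sum_congr rfl fun k _ => ?_
        rw [Int.toNat_of_nonneg (pairing_simpleRoot_nonneg (hlam k).1 i), mul_comm])
  by_contra hx
  have hxs : x ∈ s := (hs x).2 (not_le.1 fun h => hx ((O.valuation_le_one_iff _).1 h))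
  have := (Finset.sum_eq_zero_iff_of_nonneg fun j _ => hind0 _).1 (key x.1) x.2 (Finset.mem_univ _)
  simp [ind, hxs] at this

end Finiteness

/-! ### Subalgebras of the local algebra -/

section AbstractLocalAlgebra

variable {N n : ℕ} {lam : Fin n → Weight N} {l : Fin N → ℕ} {z : Fin n → ℂ} {p : Var l → ℂ}
  {A : Type*} [CommRing A] [Algebra ℂ A] {π : Poly (Var l) →ₐ[ℂ] A}

variable (lam z p π) in
/-- The properties of the local algebra at a critical point `p` that matter here: it consists of
fractions of polynomials whose denominators do not vanish at `p`, and in it the critical point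
equations hold. -/
structure IsCriticalLocalization : Prop where
  mem : p ∈ domainU lam l z
  isUnit : ∀ {a : Poly (Var l)}, MvPolynomial.eval p a ≠ 0 → IsUnit (π a)
  exists_mul_eq : ∀ x : A, ∃ a b : Poly (Var l), MvPolynomial.eval p b ≠ 0 ∧ x * π b = π a
  critical : ∀ x : Var l, π (MvPolynomial.pderiv x (masterNum l)) * π (masterDen lam l z) =
    π (masterNum l) * π (MvPolynomial.pderiv x (masterDen lam l z))

theorem exists_algebraMap_eq_of_isIntegral {K : Type*} [Field K] [Algebra ℂ K] {x : K}
    (hx : IsIntegral ℂ x) : ∃ c : ℂ, algebraMap ℂ K c = x :=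
  minpoly.mem_range_of_degree_eq_one ℂ x
    (IsAlgClosed.degree_eq_one_of_irreducible ℂ (minpoly.irreducible hx))

/-- The critical point `p` is isolated: the local algebra has a single prime ideal, since over the
residue field of a prime the coordinates are constant. -/
theorem isNilpotent_map_X_sub (hlam : ∀ s, IsPartition (lam s))
    (hinf : IsPartition (weightInfty lam l)) (hA : IsCriticalLocalization lam z p π) (x : Var l) :
    IsNilpotent (π (MvPolynomial.X x - MvPolynomial.C (p x))) := by
  rw [nilpotent_iff_mem_prime]
  intro q hq
  -- Over the fraction field of `A / q`, the image of `t_x` is a constant `c`, which must be `p_x`.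
  let K := FractionRing (A ⧸ q)
  let ψ : A →ₐ[ℂ] K :=
    (IsScalarTower.toAlgHom ℂ (A ⧸ q) K).comp (Ideal.Quotient.mkₐ ℂ q)
  have hψ : ∀ a, ψ a = 0 → a ∈ q := fun a ha => by
    rw [← Ideal.Quotient.eq_zero_iff_mem]
    exact IsFractionRing.injective (A ⧸ q) K (ha.trans (map_zero _).symm)
  let t : Var l → K := fun x => ψ (π (MvPolynomial.X x))
  have ht : ∀ f, MvPolynomial.aeval t f = ψ (π f) := fun f => by
    rw [← AlgHom.comp_apply, MvPolynomial.aeval_unique (ψ.comp (π))]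
    rfl
  have hint := isIntegral_of_critical (z := z) hlam hinf t
    (by rw [ht]; exact ((hA.isUnit (eval_masterNum_ne_zero hlam hA.mem)).map ψ).ne_zero)
    (by rw [ht]; exact ((hA.isUnit (eval_masterDen_ne_zero hlam hA.mem)).map ψ).ne_zero)
    (fun x => by
      simp only [ht]
      rw [← map_mul ψ, ← map_mul ψ, hA.critical x]) x
  obtain ⟨c, hc⟩ := exists_algebraMap_eq_of_isIntegral hint
  have hmem : π (MvPolynomial.X x - MvPolynomial.C c) ∈ q := hψ _ (by
    rw [← ht, map_sub, MvPolynomial.aeval_X, MvPolynomial.aeval_C, hc, sub_self])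
  by_cases hpc : p x = c
  · rwa [hpc]
  · exact absurd (Ideal.eq_top_of_isUnit_mem _ hmem (hA.isUnit (by
      simpa using sub_ne_zero.2 hpc))) hq.ne_top

theorem isNilpotent_map (hlam : ∀ s, IsPartition (lam s))
    (hinf : IsPartition (weightInfty lam l)) (hA : IsCriticalLocalization lam z p π) (f : Poly (Var l)) :
    IsNilpotent (π f - algebraMap ℂ A (MvPolynomial.eval p f)) := by
  rw [← mem_nilradical]
  induction f using MvPolynomial.induction_on with
  | C c =>
    rw [MvPolynomial.eval_C, ← MvPolynomial.algebraMap_eq, AlgHom.commutes, sub_self]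
    exact zero_mem _
  | add f g hf hg =>
    rw [map_add, map_add, map_add, add_sub_add_comm]
    exact add_mem hf hg
  | mul_X f x hf =>
    have hx := mem_nilradical.2 (isNilpotent_map_X_sub hlam hinf hA x)
    rw [map_sub, ← MvPolynomial.algebraMap_eq, AlgHom.commutes] at hx
    have := add_mem (Ideal.mul_mem_right (π (MvPolynomial.X x)) _ hf)
      (Ideal.mul_mem_left _ (algebraMap ℂ A (MvPolynomial.eval p f)) hx)
    convert! this using 1
    rw [map_mul, map_mul, map_mul, MvPolynomial.eval_X]
    ring

/-- Elements of a subalgebra of the local algebra that come from polynomials not vanishing at `p`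
are invertible in the subalgebra. -/
theorem isUnit_subalgebra (hlam : ∀ s, IsPartition (lam s))
    (hinf : IsPartition (weightInfty lam l)) (hA : IsCriticalLocalization lam z p π)
    (B : Subalgebra ℂ (A)) {f : Poly (Var l)} (hf : MvPolynomial.eval p f ≠ 0)
    (b : B) (hb : (b : A) = π f) : IsUnit b := by
  have h1 : IsNilpotent (b - algebraMap ℂ B (MvPolynomial.eval p f)) := by
    rw [← IsNilpotent.map_iff (f := B.val) Subtype.val_injective, map_sub, AlgHom.commutes,
      Subalgebra.coe_val, hb]
    exact isNilpotent_map hlam hinf hA f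
  have h2 : IsUnit (algebraMap ℂ B (MvPolynomial.eval p f)) := (IsUnit.mk0 _ hf).map _
  have h3 := h1.isUnit_add_right_of_commute h2 (Commute.all _ _)
  rwa [sub_add_cancel] at h3

/-- Hensel's lemma: the simple root `t_x` of `y_i`, whose coefficients are in `B`, is in `B`. -/
theorem map_X_mem (hlam : ∀ s, IsPartition (lam s))
    (hinf : IsPartition (weightInfty lam l)) (hA : IsCriticalLocalization lam z p π)
    (B : Subalgebra ℂ (A)) (i : Fin N)
    (hB : ∀ k, π ((∏ j : Fin (l i),
      (Polynomial.X - Polynomial.C (MvPolynomial.X ⟨i, j⟩ : Poly (Var l)))).coeff k) ∈ B)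
    (j : Fin (l i)) : π (MvPolynomial.X ⟨i, j⟩) ∈ B := by
  set Y : (Poly (Var l))[X] := ∏ j : Fin (l i),
      (Polynomial.X - Polynomial.C (MvPolynomial.X ⟨i, j⟩ : Poly (Var l))) with hY
  set c : ℂ := p ⟨i, j⟩ with hc
  obtain ⟨P, hP⟩ : Y.map π.toRingHom ∈ Polynomial.lifts (B.val : B →+* A) := by
    rw [Polynomial.lifts_iff_coeff_lifts]
    intro k
    rw [Polynomial.coeff_map]
    exact ⟨⟨_, hB k⟩, rfl⟩
  have hP : P.map (algebraMap B (A)) = Y.map π.toRingHom := hP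
  have heval : ∀ (Q : B[X]) (Z : (Poly (Var l))[X]),
      Q.map (algebraMap B (A)) = Z.map π.toRingHom →
      ((Polynomial.aeval (algebraMap ℂ B c) Q : B) : A) =
        π (Z.eval (MvPolynomial.C c)) := by
    intro Q Z h
    have h1 := congrArg (Polynomial.eval (algebraMap ℂ (A) c)) h
    have h2 : algebraMap ℂ (A) c = π.toRingHom (MvPolynomial.C c) :=
      (π.commutes c).symm
    rw [h2, Polynomial.eval_map_apply, ← h2,
      IsScalarTower.algebraMap_apply ℂ B (A), Polynomial.eval_map_apply] at h1
    exact h1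
  -- The constant `c = p_x` is an approximate root: `y_i(c)` is nilpotent and `y_i'(c)` is a unit.
  have hroot : MvPolynomial.eval p (Y.eval (MvPolynomial.C c)) = 0 := by
    rw [hY, Polynomial.eval_prod, map_prod]
    exact Finset.prod_eq_zero (Finset.mem_univ j) (by simp [hc])
  have hsimple : MvPolynomial.eval p (Y.derivative.eval (MvPolynomial.C c)) ≠ 0 := by
    have hinj : Function.Injective fun j : Fin (l i) => p ⟨i, j⟩ := by
      have h := eval_masterNum_ne_zero hlam hA.mem
      simp only [masterNum, map_prod, map_pow, map_sub, MvPolynomial.eval_X,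
        Finset.prod_ne_zero_iff, Finset.mem_univ, true_imp_iff, Finset.mem_filter, true_and] at h
      intro a b hab
      by_contra hne
      rcases lt_or_gt_of_ne hne with hlt | hlt
      · exact h i a b hlt (by rw [show p ⟨i, a⟩ = p ⟨i, b⟩ from hab, sub_self, zero_pow two_ne_zero])
      · exact h i b a hlt (by rw [show p ⟨i, a⟩ = p ⟨i, b⟩ from hab, sub_self, zero_pow two_ne_zero])
    have hsep := Polynomial.separable_prod_X_sub_C_iff.2 hinj
    have hmap : Y.map (MvPolynomial.eval p) =
        ∏ j : Fin (l i), (Polynomial.X - Polynomial.C (p ⟨i, j⟩)) := by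
      simp [hY, Polynomial.map_prod]
    have h1 : (Y.map (MvPolynomial.eval p)).eval c = 0 := by
      rw [hmap, Polynomial.eval_prod]
      exact Finset.prod_eq_zero (Finset.mem_univ j) (by simp [hc])
    have h2 := (hmap ▸ hsep).eval₂_derivative_ne_zero (RingHom.id ℂ) h1
    rw [Polynomial.derivative_map] at h2
    have h3 : c = MvPolynomial.eval p (MvPolynomial.C c) := by simp
    rw [Polynomial.eval₂_id, h3, Polynomial.eval_map_apply] at h2
    exact h2
  have hnil : IsNilpotent (Polynomial.aeval (algebraMap ℂ B c) P) := by
    rw [← IsNilpotent.map_iff (f := B.val) Subtype.val_injective, Subalgebra.coe_val,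
      heval P Y hP]
    simpa [hroot] using isNilpotent_map hlam hinf hA (Y.eval (MvPolynomial.C c))
  have hder : IsUnit (Polynomial.aeval (algebraMap ℂ B c) (Polynomial.derivative P)) :=
    isUnit_subalgebra hlam hinf hA B hsimple _
      (heval _ _ (by rw [← Polynomial.derivative_map, hP, Polynomial.derivative_map]))
  -- Newton's method in `B` gives a root in `B`, which is `t_x` by uniqueness in `A`.
  obtain ⟨r, ⟨hr1, hr2⟩, -⟩ := Polynomial.existsUnique_nilpotent_sub_and_aeval_eq_zero hnil hder
  have hcast : ∀ (Q : B[X]) (b : B), Polynomial.aeval (algebraMap B (A) b) Q =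
      algebraMap B (A) (Polynomial.aeval b Q) :=
    fun Q b => Polynomial.aeval_algebraMap_apply _ _ _
  have huniq := (Polynomial.existsUnique_nilpotent_sub_and_aeval_eq_zero (P := P)
    (x := algebraMap B (A) (algebraMap ℂ B c))
    (by rw [hcast]; exact hnil.map _) (by rw [hcast]; exact hder.map _)).unique
    (y₁ := π (MvPolynomial.X ⟨i, j⟩)) (y₂ := algebraMap B (A) r)
    ⟨?_, ?_⟩ ⟨?_, ?_⟩
  · rw [huniq]
    exact r.2
  · have h := (isNilpotent_map_X_sub hlam hinf hA ⟨i, j⟩).neg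
    rw [← map_neg, neg_sub, map_sub, ← MvPolynomial.algebraMap_eq, AlgHom.commutes] at h
    rwa [← IsScalarTower.algebraMap_apply]
  · rw [← Polynomial.eval_map_algebraMap, hP]
    have h2 : π (MvPolynomial.X ⟨i, j⟩) = π.toRingHom (MvPolynomial.X ⟨i, j⟩) := rfl
    rw [h2, Polynomial.eval_map_apply, hY, Polynomial.eval_prod,
      Finset.prod_eq_zero (Finset.mem_univ j) (by simp), map_zero]
  · rw [← map_sub]
    exact hr1.map _
  · rw [hcast, hr2, map_zero]

/-- A subalgebra that contains the coefficients of all the `y_i` is the whole local algebra. -/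
theorem eq_top_of_coeff_mem (hlam : ∀ s, IsPartition (lam s))
    (hinf : IsPartition (weightInfty lam l)) (hA : IsCriticalLocalization lam z p π)
    (B : Subalgebra ℂ A)
    (hB : ∀ i k, π ((∏ j : Fin (l i),
      (Polynomial.X - Polynomial.C (MvPolynomial.X ⟨i, j⟩ : Poly (Var l)))).coeff k) ∈ B) :
    B = ⊤ := by
  have hpoly : ∀ f : Poly (Var l), π f ∈ B := by
    intro f
    induction f using MvPolynomial.induction_on with
    | C c =>
      rw [← MvPolynomial.algebraMap_eq, AlgHom.commutes]
      exact B.algebraMap_mem c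
    | add f g hf hg =>
      rw [map_add]
      exact add_mem hf hg
    | mul_X f x hf =>
      rw [map_mul]
      exact mul_mem hf (map_X_mem hlam hinf hA B x.1 (hB x.1) x.2)
  rw [eq_top_iff]
  rintro x -
  obtain ⟨a, b, hb, hx⟩ := hA.exists_mul_eq x
  obtain ⟨u, hu⟩ := (isUnit_subalgebra hlam hinf hA B hb ⟨_, hpoly b⟩ rfl).exists_right_inv
  have hu : π b * (u : A) = 1 := congrArg Subtype.val hu
  have : x = π a * u := by
    rw [← hx, mul_assoc, hu, mul_one]
  rw [this]
  exact mul_mem (hpoly a) u.2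

end AbstractLocalAlgebra

/-! ### The local algebra at a critical point -/

section LocalAlgebra

variable {N n : ℕ} {lam : Fin n → Weight N} {l : Fin N → ℕ} {z : Fin n → ℂ} {p : Var l → ℂ}

/-- The homomorphism from `ℂ[t]` to the local algebra at `p`. -/
def polyToLocal (hp : p ∈ criticalSet lam l z) : Poly (Var l) →ₐ[ℂ] LocalAlgebra hp :=
  (toLocal hp).comp ((IsScalarTower.toAlgHom ℂ (Poly (Var l)) (RatField (Var l))).codRestrict
    (regularAlgebra (domainU lam l z)) fun a => (polyRegular (domainU lam l z) a).2)

theorem isUnit_toLocal (hp : p ∈ criticalSet lam l z) {f : RegU lam l z}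
    (hf : evalHom hp.fst f ≠ 0) : IsUnit (toLocal hp f) :=
  IsLocalization.map_units (M := (maxIdealAt hp).primeCompl) (LocalAlgebra hp)
    ⟨Ideal.Quotient.mk _ f, hf⟩

theorem evalHom_polyRegular {U : Set (Var l → ℂ)} (hp : p ∈ U) (a : Poly (Var l)) :
    evalHom hp (polyRegular U a) = MvPolynomial.eval p a :=
  (hasValueAt_valueAt hp (polyRegular U a)).unique (hasValueAt_toRat a p)

/-- If `A` consists of fractions of regular functions, then it consists of fractions of
polynomials. -/
theorem exists_mul_polyRegular_eq {A : Type*} [CommRing A] {U : Set (Var l → ℂ)} (hp : p ∈ U)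
    (τ : regularAlgebra U →+* A)
    (hτ : ∀ x : A, ∃ f g, evalHom hp g ≠ 0 ∧ x * τ g = τ f) (x : A) :
    ∃ a b : Poly (Var l), MvPolynomial.eval p b ≠ 0 ∧
      x * τ (polyRegular U b) = τ (polyRegular U a) := by
  have key : ∀ f : regularAlgebra U, ∃ a b : Poly (Var l), MvPolynomial.eval p b ≠ 0 ∧
      f * polyRegular U b = polyRegular U a := by
    intro f
    obtain ⟨v, a, b, hb, hf, -⟩ := f.2 p hp
    refine ⟨a, b, hb, Subtype.ext ?_⟩
    change (f : RatField (Var l)) * toRat b = toRat a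
    rw [hf, div_mul_cancel₀ _ (toRat_ne_zero hb)]
  have hmul : ∀ a b : Poly (Var l), polyRegular U (a * b) = polyRegular U a * polyRegular U b :=
    fun a b => Subtype.ext (toRat_mul a b)
  obtain ⟨f, g, hg, hx⟩ := hτ x
  obtain ⟨a, b, hb, hf⟩ := key f
  obtain ⟨c, d, hd, hg'⟩ := key g
  refine ⟨a * d, c * b, ?_, ?_⟩
  · have h := congrArg (evalHom hp) hg'
    rw [map_mul, evalHom_polyRegular, evalHom_polyRegular] at h
    rw [map_mul, ← h]
    exact mul_ne_zero (mul_ne_zero hg hd) hb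
  · rw [hmul, hmul, ← hf, ← hg']
    simp only [map_mul]
    linear_combination (τ (polyRegular U d) * τ (polyRegular U b)) * hx

theorem critical_of_map_Psi_eq_zero {A : Type*} [CommRing A] (hlam : ∀ s, IsPartition (lam s))
    (hp : p ∈ domainU lam l z) (τ : RegU lam l z →+* A) (x : Var l)
    (h0 : τ (Psi lam l z x) = 0) :
    τ (polyRegular (domainU lam l z) (MvPolynomial.pderiv x (masterNum l))) *
        τ (polyRegular (domainU lam l z) (masterDen lam l z)) =
      τ (polyRegular (domainU lam l z) (masterNum l)) *
        τ (polyRegular (domainU lam l z) (MvPolynomial.pderiv x (masterDen lam l z))) := by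
  have h := congrArg τ (Psi_mul_eq (z := z) hlam x
    (fun h => eval_masterNum_ne_zero hlam hp (by rw [h, map_zero]))
    (fun h => eval_masterDen_ne_zero hlam hp (by rw [h, map_zero])))
  rw [map_mul, h0, zero_mul, map_sub, map_mul, map_mul] at h
  exact (sub_eq_zero.1 h.symm)

theorem exists_toLocal_mul_eq (hp : p ∈ criticalSet lam l z) (x : LocalAlgebra hp) :
    ∃ f g : RegU lam l z, evalHom hp.fst g ≠ 0 ∧ x * toLocal hp g = toLocal hp f := by
  obtain ⟨⟨r, s, hs⟩, hx⟩ := IsLocalization.surj (R := APhi lam l z)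
    (S := LocalAlgebra hp) (maxIdealAt hp).primeCompl x
  obtain ⟨f, rfl⟩ := Ideal.Quotient.mk_surjective r
  obtain ⟨g, rfl⟩ := Ideal.Quotient.mk_surjective s
  exact ⟨f, g, hs, hx⟩

set_option synthInstance.maxHeartbeats 400000 in
theorem toLocal_Psi (hp : p ∈ criticalSet lam l z) (x : Var l) :
    toLocal hp (Psi lam l z x) = 0 := by
  have h : Ideal.Quotient.mkₐ ℂ (idealPhi lam l z) (Psi lam l z x) = 0 :=
    Ideal.Quotient.eq_zero_iff_mem.2 (Ideal.subset_span ⟨x, rfl⟩)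
  rw [toLocal, AlgHom.comp_apply, h, map_zero]

/-- The ring structure of the local algebra. It extends the semiring structure that `LocalAlgebra`
carries, so that algebra homomorphisms and subalgebras mean the same for both. -/
abbrev commRingLocalAlgebra (hp : p ∈ criticalSet lam l z) : CommRing (LocalAlgebra hp) :=
  (algebraMap ℂ (LocalAlgebra hp)).commSemiringToCommRing

set_option synthInstance.maxHeartbeats 400000 in
theorem isCriticalLocalization (hlam : ∀ s, IsPartition (lam s)) (hp : p ∈ criticalSet lam l z) :
    let := commRingLocalAlgebra hp
    IsCriticalLocalization (A := LocalAlgebra hp) lam z p (polyToLocal hp) := by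
  let := commRingLocalAlgebra hp
  exact {
    mem := hp.fst
    isUnit := fun {a} ha => isUnit_toLocal hp (f := polyRegular (domainU lam l z) a)
      (by rwa [evalHom_polyRegular])
    exists_mul_eq := exists_mul_polyRegular_eq hp.fst
      (toLocal hp : RegU lam l z →+* LocalAlgebra hp) (exists_toLocal_mul_eq hp)
    critical := fun x => critical_of_map_Psi_eq_zero hlam hp.fst
      (toLocal hp : RegU lam l z →+* LocalAlgebra hp) x (toLocal_Psi hp x) }

end LocalAlgebra

end GaudinMaster

end

theorem theorem2p1 {N n : ℕ} (lam : Fin n → GaudinMaster.Weight N) (l : Fin N → ℕ)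
    (z : Fin n → ℂ)
    (hlam : ∀ s, GaudinMaster.IsPartition (lam s))
    (hlast : ∀ s, lam s (Fin.last N) = 0)
    (hinf : GaudinMaster.IsPartition (GaudinMaster.weightInfty lam l))
    (hz : Function.Injective z)
    (p : GaudinMaster.Var l → ℂ) (hp : p ∈ GaudinMaster.criticalSet lam l z) :
    Algebra.adjoin ℂ {x : GaudinMaster.LocalAlgebra hp |
      ∃ i j : ℕ, 1 ≤ i ∧ i ≤ N + 1 ∧ i ≤ j ∧ x = GaudinMaster.coeffGBar hp i j} = ⊤ := by
  let := GaudinMaster.commRingLocalAlgebra hp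
  refine GaudinMaster.eq_top_of_coeff_mem (A := GaudinMaster.LocalAlgebra hp) hlam hinf
    (GaudinMaster.isCriticalLocalization hlam hp) _ fun i k => ?_
  have h : GaudinMaster.algebraG lam l z ≤ (Algebra.adjoin ℂ {x : GaudinMaster.LocalAlgebra hp |
      ∃ i j : ℕ, 1 ≤ i ∧ i ≤ N + 1 ∧ i ≤ j ∧ x = GaudinMaster.coeffGBar hp i j}).comap
      (GaudinMaster.polyToLocal hp) := by
    refine Algebra.adjoin_le ?_
    rintro _ ⟨i, j, hi, hi', hj, rfl⟩
    exact Algebra.subset_adjoin ⟨i, j, hi, hi', hj, rfl⟩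
  exact h (GaudinMaster.coeff_prod_level_mem lam l z hlam hlast hinf i k)
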